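/- **Conventions.** Hilbert spaces are complex and separable, with inner product $(\cdot,\cdot)$ linear in the first argument. For a bounded operator $A$ on a Hilbert space $\mathcal H$ put $A_I=\frac{A-A^*}{2i}$. $A$ is *dissipative* if $A_I\ge 0$, *has rank one imaginary part* if $\dim\operatorname{ran}A_I=1$, and is *prime* if there is no nonzero closed subspace reducing $A$ on which $A$ is self-adjoint. If $A$ is prime and dissipative with rank one imaginary part, the *Weyl function* of $A$ is $m_A(z)=((A-zI)^{-1}e,e)$, $z\in\rho(A)$, where $e\in\operatorname{ran}(A-A^*)$, $\|e\|=1$. If $A$ is dissipative with rank one imaginary part, a *characteristic function* of $A$ is $W(z)=1-i((A-zI)^{-1}g,g)$, $z\in\rho(A)$, where $g\in\mathcal H$ satisfies $2A_Ih=(h,g)g$ for all $h\in\mathcal H$. A function on an open set $U$ *is* the Weyl function (a characteristic function) of $A$ if $U\subset\rho(A)$ and it coincides with that function on $U$. A *Herglotz–Nevanlinna function* on $\mathbb C\setminus[\alpha,\beta]$ (where $\alpha\le\beta$ are real) is a holomorphic function $F$ there with $F(\bar z)=\overline{F(z)}$ and $\operatorname{Im}F(z)/\operatorname{Im}z\ge0$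 for $\operatorname{Im}z\ne0$. **Theorem.** Let $\mathcal D$ be a closed bounded subset of the closed upper half-plane $\{\operatorname{Im}z\ge0\}$ and let $M$ be holomorphic on $U=\mathbb C\setminus\mathcal D$. The following statements are equivalent. 1. $M$ is (on $U$) the Weyl function of some bounded prime dissipative operator with rank one imaginary part. 2. There is $b\in\mathbb C$ with $\operatorname{Im}b>0$ such that $$M(z)=-\frac1z-\frac b{z^2}+O\Big(\frac1{z^3}\Big)\quad(z\to\infty),\tag{$*$}$$ and $1-2i\,\operatorname{Im}b\,M(z)$ is (on $U$) a characteristic function of some bounded dissipative operator with rank one imaginary part. 3. There is $b$ with $\operatorname{Im}b>0$ such that $(*)$ holds and $$\mathcal K(z,\xi)=\frac{M(z)-\overline{M(\xi)}+2i\,\operatorname{Im}b\,M(z)\overline{M(\xi)}}{z-\bar\xi}$$ is a nonnegative kernel on $U$: $\sum_{i,j=1}^n\lambda_i\overline{\lambda_j}\,\mathcal K(z_j,z_i)\ge0$ for all $n$, all $\lambda_1,\dots,\lambda_n\in\mathbb C$ and all $z_1,\dots,z_n\in U$ with $z_i\ne\overline{z_j}$ for all $i,j$. 4. There is $b$ with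 $\operatorname{Im}b>0$ such that $(*)$ holds and $Q(z)=\dfrac{iM(z)}{i+\operatorname{Im}b\,M(z)}$ has an analytic continuation to the outside of a bounded interval of the real axis as a Herglotz–Nevanlinna function: there are real $\alpha\le\beta$ and a Herglotz–Nevanlinna function $F$ on $\mathbb C\setminus[\alpha,\beta]$ such that at every point of $U\setminus[\alpha,\beta]$ the denominator of $Q$ is nonzero and $F=Q$. 5. There is $b$ with $\operatorname{Im}b>0$ such that $(*)$ holds and $-\dfrac1{M(z)}+b$ has, in the same sense (with $M\ne0$ on $U\setminus[\alpha,\beta]$), an analytic continuation to the outside of a bounded interval of the real axis as a Herglotz–Nevanlinna function. -/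

import Mathlib

open scoped ComplexConjugate ComplexOrder
open Asymptotics

noncomputable section

section Operators

variable {H : Type*} [NormedAddCommGroup H] [InnerProductSpace ℂ H] [CompleteSpace H]

/-- The imaginary part `A_I = (A - A*) / (2 i)` of a bounded operator `A`. -/
def imPart (A : H →L[ℂ] H) : H →L[ℂ] H :=
  (2 * Complex.I)⁻¹ • (A - ContinuousLinearMap.adjoint A)

/-- `A` is dissipative: `A_I ≥ 0`. -/
def IsDissipative (A : H →L[ℂ] H) : Prop :=
  (imPart A).IsPositive

/-- The imaginary part of `A` has rank one. -/
def HasRankOneImPart (A : H →L[ℂ] H) : Prop :=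
  Module.finrank ℂ (LinearMap.range (imPart A : H →ₗ[ℂ] H)) = 1

/-- `A` is prime (completely non-self-adjoint): there is no nonzero closed subspace `S`
reducing `A` (both `S` and its orthogonal complement are invariant under `A`) on which `A` is
self-adjoint. -/
def IsPrimeOperator (A : H →L[ℂ] H) : Prop :=
  ∀ S : Submodule ℂ H, IsClosed (S : Set H) →
    (∀ x ∈ S, A x ∈ S) → (∀ x ∈ Sᗮ, A x ∈ Sᗮ) →
    (∀ x ∈ S, ∀ y ∈ S, inner ℂ (A x) y = inner ℂ x (A y)) → S = ⊥

/-- The function `z ↦ ((A - z I)⁻¹ x, x)`, with the inner product linear in its first argument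
(Mathlib's is linear in the second one). It is meaningful for `z` in the resolvent set. -/
def resolventForm (A : H →L[ℂ] H) (x : H) (z : ℂ) : ℂ :=
  inner ℂ x (Ring.inverse (A - algebraMap ℂ (H →L[ℂ] H) z) x)

/-- `g` is a channel vector of `A`: `2 A_I h = (h, g) g` for all `h`. -/
def IsChannelVector (A : H →L[ℂ] H) (g : H) : Prop :=
  ∀ h : H, (2 : ℂ) • imPart A h = inner ℂ g h • g

/-- The restriction of `m` to `U` is the Weyl function of `A`: `U` lies in the resolvent set and
`m z = ((A - z I)⁻¹ e, e)` on `U` for a unit vector `e` in the range of `A - A*`. -/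
def IsWeylFunctionOn (A : H →L[ℂ] H) (m : ℂ → ℂ) (U : Set ℂ) : Prop :=
  ∃ e : H, e ∈ LinearMap.range ((A - ContinuousLinearMap.adjoint A : H →L[ℂ] H) : H →ₗ[ℂ] H) ∧
    ‖e‖ = 1 ∧ ∀ z ∈ U, z ∈ resolventSet ℂ A ∧ m z = resolventForm A e z

/-- The restriction of `W` to `U` is a characteristic function of `A`: `U` lies in the resolvent
set and `W z = 1 - i ((A - z I)⁻¹ g, g)` on `U` for a channel vector `g` of `A`. -/
def IsCharacteristicFunctionOn (A : H →L[ℂ] H) (W : ℂ → ℂ) (U : Set ℂ) : Prop :=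
  ∃ g : H, IsChannelVector A g ∧
    ∀ z ∈ U, z ∈ resolventSet ℂ A ∧ W z = 1 - Complex.I * resolventForm A g z

end Operators

/-- `M z = -1/z - b/z² + O(z⁻³)` as `z → ∞`, with `Im b > 0`. -/
def HasWeylExpansion (M : ℂ → ℂ) (b : ℂ) : Prop :=
  0 < b.im ∧
    (fun z : ℂ => M z - (-1 / z - b / z ^ 2)) =O[Bornology.cobounded ℂ] fun z : ℂ => 1 / z ^ 3

/-- The kernel `(M(z) - conj M(ξ) + 2 i Im b M(z) conj M(ξ)) / (z - conj ξ)`; it is meaningful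
for `z ≠ conj ξ`. -/
def weylKernel (M : ℂ → ℂ) (b : ℂ) (z ξ : ℂ) : ℂ :=
  (M z - conj (M ξ) + 2 * Complex.I * (b.im : ℂ) * M z * conj (M ξ)) / (z - conj ξ)

/-- `K`, a kernel defined at the pairs `(z, ξ)` of points of `U` with `z ≠ conj ξ`, is nonnegative:
`∑ᵢⱼ λᵢ conj(λⱼ) K(zⱼ, zᵢ) ≥ 0` for all finite families of points of `U` at all of whose pairs it
is defined. (The inequality in `ℂ` says that the sum is real and nonnegative.) -/
def IsNonnegativeKernelOn (K : ℂ → ℂ → ℂ) (U : Set ℂ) : Prop :=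
  ∀ (n : ℕ) (z : Fin n → ℂ) (c : Fin n → ℂ), (∀ i, z i ∈ U) → (∀ i j, z i ≠ conj (z j)) →
    0 ≤ ∑ i, ∑ j, c i * conj (c j) * K (z j) (z i)

/-- The outside of the bounded interval `[α, β]` of the real axis in the complex plane. -/
def outsideInterval (α β : ℝ) : Set ℂ :=
  ((fun t : ℝ => (t : ℂ)) '' Set.Icc α β)ᶜ

/-- `F` is a Herglotz-Nevanlinna function on the outside of `[α, β]`: it is holomorphic there,
`F (conj z) = conj (F z)`, and `(F z - conj (F z)) / (z - conj z) = Im (F z) / Im z ≥ 0` off the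
real axis. -/
structure IsHerglotzNevanlinnaOutside (F : ℂ → ℂ) (α β : ℝ) : Prop where
  holo : DifferentiableOn ℂ F (outsideInterval α β)
  symm : ∀ z ∈ outsideInterval α β, F (conj z) = conj (F z)
  nonneg : ∀ z : ℂ, z.im ≠ 0 → 0 ≤ (F z).im / z.im

/-- The function `Q` on `U`, given by a quotient with denominator `P`, has an analytic continuation
onto the outside of some bounded interval `[α, β]` of the real axis as a Herglotz-Nevanlinna
function `F`: at all points of `U` outside `[α, β]` the quotient is defined and equals `F`. In the
uses below the numerator does not vanish where `P` does, so `Q` has a pole at each isolated zero of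
`P`, and makes no sense where `P` vanishes identically; therefore a continuation requires
`P ≠ 0` there. -/
def ExtendsToHerglotzNevanlinna (Q P : ℂ → ℂ) (U : Set ℂ) : Prop :=
  ∃ α β : ℝ, α ≤ β ∧ ∃ F : ℂ → ℂ, IsHerglotzNevanlinnaOutside F α β ∧
    ∀ z ∈ U, z ∈ outsideInterval α β → P z ≠ 0 ∧ F z = Q z

end

/-! The implications run 1 → 2 → 3 → 5 → 4 → 1, always with the same `b`, which for an operator `A`
is `(Ae, e)`.

For 1 → 2, the rank one imaginary part is `Im b (·, e) e`, so `√(2 Im b) e` is a channel vector, and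
two steps of the resolvent identity give the expansion. For 2 → 3, the kernel is a Gram kernel of
the vectors `(A* - z̄)⁻¹ g`.

For 3 → 5, the lower half-plane lies in the domain of `M`. One-point positivity controls the sign of
`Im (-1/M + b)` there. Two-point positivity bounds the kernel near conjugate points, so its
numerator vanishes at them. This says that `-1/M + b` commutes with conjugation, and reflection of
its values from the lower half-plane gives the continuation (`IsNonnegativeKernelOn.symmetry`). For
5 → 4, if `F` continues `-1/M + b`, then `-1/(F - Re b)` continues `Q`.

The substance is 4 → 1. Since `zQ(z) → -1`, the function `Q` should be `((B - z)⁻¹e, e)` with `B`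
bounded self-adjoint and `e` a cyclic unit vector (`exists_selfAdjoint_of_herglotz`). The map `z =
ρ(u + 1/u)` turns `Q` into a typically real function on the disc. Circle averages represent its
dilates by positive functionals on `C([-2, 2])`, a limit along an ultrafilter represents the
function itself, and the GNS construction produces `B`. Put `A = B + i Im b (·, e) e`. The rank one
resolvent formula undoes the Möbius transformation and returns `M`.

This settles nonreal points only. At a real point where `M` is holomorphic, the resolvent of `A`
grows at most quadratically nearby, while its matrix elements between the orbits of `e` under `A`
and `A*` continue holomorphically. A maximum principle makes the resolvent uniformly bounded on a
vertical segment ending at the point, which is therefore regular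
(`mem_resolventSet_of_holomorphic_form`). -/

/-! ### GNS representation of a positive functional on `C(X)`. -/

section Cyclic

/-- The positive functional `L` on `C(X, ℂ)` is a vector state of a cyclic representation, and
`a` acts in it as a self-adjoint operator whose powers generate the space. -/
lemma exists_selfAdjoint_cyclic_of_positive {X : Type} [TopologicalSpace X] [CompactSpace X]
    (L : C(X, ℂ) →ₗ[ℂ] ℂ) (hL : ∀ f : C(X, ℂ), 0 ≤ f → 0 ≤ L f) (hL1 : L 1 = 1)
    (a : C(X, ℂ)) (ha : star a = a) (hinj : Function.Injective a) :
    ∃ (H : Type) (_ : NormedAddCommGroup H) (_ : InnerProductSpace ℂ H) (_ : CompleteSpace H)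
      (B : H →L[ℂ] H) (e : H), ContinuousLinearMap.adjoint B = B ∧ ‖e‖ = 1 ∧
      (Submodule.span ℂ (Set.range fun n : ℕ => (B ^ n) e)).topologicalClosure = ⊤ ∧
      ∀ (z : ℂ) (g : C(X, ℂ)), (∀ t, g t * (a t - z) = 1) →
        z ∈ resolventSet ℂ B ∧ resolventForm B e z = L g := by
  let Λ : C(X, ℂ) →ₚ[ℂ] ℂ := PositiveLinearMap.mk₀ L hL
  have hΛ : ∀ f, Λ f = L f := fun f => rfl
  let π := Λ.gnsStarAlgHom
  let e : Λ.GNS := ((Λ.toPreGNS 1 : Λ.PreGNS) : Λ.GNS)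
  have hπe : ∀ f : C(X, ℂ), π f e = ((Λ.toPreGNS f : Λ.PreGNS) : Λ.GNS) := by
    intro f
    simp [π, e]
  have hB : ContinuousLinearMap.adjoint (π a) = π a := by
    rw [← ContinuousLinearMap.star_eq_adjoint, ← map_star, ha]
  refine ⟨Λ.GNS, inferInstance, inferInstance, inferInstance, π a, e, hB, ?_, ?_, ?_⟩
  · have h1 : ‖e‖ = ‖(Λ.toPreGNS 1 : Λ.PreGNS)‖ := UniformSpace.Completion.norm_coe _
    rw [h1, Λ.preGNS_norm_def]
    simp [hΛ, hL1]
  · set V := Submodule.span ℂ (Set.range fun n : ℕ => ((π a) ^ n) e) with hV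
    have heV : e ∈ V := Submodule.subset_span ⟨0, by simp⟩
    have hBV : ∀ v ∈ V, π a v ∈ V := by
      intro v hv
      induction hv using Submodule.span_induction with
      | mem x hx =>
        obtain ⟨n, rfl⟩ := hx
        exact Submodule.subset_span ⟨n + 1, by simp [pow_succ']⟩
      | zero => simp
      | add x y _ _ hx hy => rw [map_add]; exact V.add_mem hx hy
      | smul c x _ hx => rw [map_smul]; exact V.smul_mem c hx
    have hadj : ∀ f ∈ Algebra.adjoin ℂ {a}, ∀ v ∈ V, π f v ∈ V := by
      intro f hf
      induction hf using Algebra.adjoin_induction with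
      | mem x hx => rw [Set.mem_singleton_iff.1 hx]; exact hBV
      | algebraMap r =>
        intro v hv
        rw [AlgHomClass.commutes, Algebra.algebraMap_eq_smul_one]
        exact V.smul_mem r hv
      | add x y _ _ hx hy =>
        intro v hv
        rw [map_add]
        exact V.add_mem (hx v hv) (hy v hv)
      | mul x y _ _ hx hy =>
        intro v hv
        rw [map_mul]
        exact hx _ (hy v hv)
    -- Stone–Weierstrass: the polynomials in `a` are closed under `star` because `a` is
    -- self-adjoint, and separate points because `a` is injective. Hence every `π f e` is a limit of
    -- vectors in the span of the orbit.
    let S : StarSubalgebra ℂ C(X, ℂ) :=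
      { Algebra.adjoin ℂ {a} with
        star_mem' := by
          intro f hf
          induction hf using Algebra.adjoin_induction with
          | mem x hx =>
            rw [Set.mem_singleton_iff.1 hx, ha]
            exact Algebra.subset_adjoin rfl
          | algebraMap r =>
            rw [← algebraMap_star_comm]
            exact Subalgebra.algebraMap_mem _ _
          | add x y _ _ hx hy =>
            rw [star_add]
            exact (Algebra.adjoin ℂ {a}).add_mem hx hy
          | mul x y _ _ hx hy =>
            rw [star_mul]
            exact (Algebra.adjoin ℂ {a}).mul_mem hy hx }
    have hS : S.topologicalClosure = ⊤ := by
      apply ContinuousMap.starSubalgebra_topologicalClosure_eq_top_of_separatesPoints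
      intro x y hxy
      exact ⟨a, ⟨a, Algebra.subset_adjoin rfl, rfl⟩, fun h => hxy (hinj h)⟩
    have hcont : Continuous fun f : C(X, ℂ) => π f e :=
      (ContinuousLinearMap.apply ℂ Λ.GNS e).continuous.comp (map_continuous π)
    have hall : ∀ f : C(X, ℂ), π f e ∈ closure (V : Set Λ.GNS) := by
      intro f
      have hf : f ∈ closure (S : Set C(X, ℂ)) := by
        rw [← StarSubalgebra.topologicalClosure_coe, hS]; trivial
      exact map_mem_closure (f := fun f : C(X, ℂ) => π f e) hcont hf fun g hg => hadj g hg e heV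
    rw [eq_top_iff]
    rintro x -
    change x ∈ closure (V : Set Λ.GNS)
    induction x using UniformSpace.Completion.induction_on with
    | hp => exact isClosed_closure
    | ih x =>
      have := hall (Λ.ofPreGNS x)
      rwa [hπe] at this
  · intro z g hg
    have h1 : g * (a - algebraMap ℂ _ z) = 1 := by
      ext t
      exact hg t
    have h2 : π g * (π a - algebraMap ℂ _ z) = 1 := by
      rw [← AlgHomClass.commutes π z, ← map_sub, ← map_mul, h1, map_one]
    have h3 : (π a - algebraMap ℂ _ z) * π g = 1 := by
      rw [← AlgHomClass.commutes π z, ← map_sub, ← map_mul, mul_comm, h1, map_one]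
    let u : (Λ.GNS →L[ℂ] Λ.GNS)ˣ := ⟨_, _, h3, h2⟩
    have hu : (u : Λ.GNS →L[ℂ] Λ.GNS) = π a - algebraMap ℂ _ z := rfl
    refine ⟨?_, ?_⟩
    · rw [spectrum.mem_resolventSet_iff, IsUnit.sub_iff]
      exact u.isUnit
    · rw [resolventForm, ← hu, Ring.inverse_unit]
      change inner ℂ e (π g e) = _
      rw [hπe, UniformSpace.Completion.inner_coe, Λ.preGNS_inner_def]
      simp [hΛ]

end Cyclic

/-! ### Resolvents, rank one imaginary parts and the Gram form of the kernel. -/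

section ResolventForms

variable {H : Type*} [NormedAddCommGroup H] [InnerProductSpace ℂ H]

lemma mem_resolventSet_iff_isUnit_sub (A : H →L[ℂ] H) (z : ℂ) :
    z ∈ resolventSet ℂ A ↔ IsUnit (A - algebraMap ℂ (H →L[ℂ] H) z) := by
  rw [spectrum.mem_resolventSet_iff, IsUnit.sub_iff]

lemma exists_inverse_of_mem_resolventSet {A : H →L[ℂ] H} {z : ℂ} (hz : z ∈ resolventSet ℂ A) :
    ∃ R : H →L[ℂ] H, (∀ x, R (A x - z • x) = x) ∧ (∀ x, A (R x) - z • R x = x) ∧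
      Ring.inverse (A - algebraMap ℂ (H →L[ℂ] H) z) = R := by
  obtain ⟨u, hu⟩ := (mem_resolventSet_iff_isUnit_sub A z).1 hz
  refine ⟨(u⁻¹ : (H →L[ℂ] H)ˣ), fun x => ?_, fun x => ?_, ?_⟩
  · have := congrArg (fun T : H →L[ℂ] H => T x) u.inv_mul
    rw [hu] at this
    simpa [Algebra.algebraMap_eq_smul_one] using this
  · have := congrArg (fun T : H →L[ℂ] H => T x) u.mul_inv
    rw [hu] at this
    simpa [Algebra.algebraMap_eq_smul_one] using this
  · rw [← hu, Ring.inverse_unit]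

lemma mem_resolventSet_of_inverse {A R : H →L[ℂ] H} {z : ℂ}
    (h1 : ∀ x, R (A x - z • x) = x) (h2 : ∀ x, A (R x) - z • R x = x) :
    z ∈ resolventSet ℂ A ∧ Ring.inverse (A - algebraMap ℂ (H →L[ℂ] H) z) = R := by
  let u : (H →L[ℂ] H)ˣ :=
    ⟨A - algebraMap ℂ (H →L[ℂ] H) z, R,
      by ext x; simpa [Algebra.algebraMap_eq_smul_one] using h2 x,
      by ext x; simpa [Algebra.algebraMap_eq_smul_one] using h1 x⟩
  have hu : (u : H →L[ℂ] H) = A - algebraMap ℂ (H →L[ℂ] H) z := rfl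
  refine ⟨(mem_resolventSet_iff_isUnit_sub A z).2 (hu ▸ u.isUnit), ?_⟩
  rw [← hu, Ring.inverse_unit]
  rfl

/-- The bound `‖(A - z)⁻¹ x‖ ≤ ‖x‖ / (|z| - ‖A‖)`. -/
lemma norm_sub_mul_norm_resolvent_le {A : H →L[ℂ] H} {z : ℂ} {x y : H}
    (h : A y - z • y = x) : (‖z‖ - ‖A‖) * ‖y‖ ≤ ‖x‖ := by
  have h1 : ‖z • y‖ ≤ ‖A y‖ + ‖x‖ := by
    have : z • y = A y - x := by rw [← h]; abel
    rw [this]; exact norm_sub_le _ _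
  have h2 := A.le_opNorm y
  rw [norm_smul] at h1
  nlinarith

/-- The expansion of the resolvent form at infinity. -/
lemma resolventForm_expansion (A : H →L[ℂ] H) {e : H} (he : ‖e‖ = 1) {m : ℂ → ℂ}
    (hm : ∀ᶠ z in Bornology.cobounded ℂ, z ∈ resolventSet ℂ A ∧ m z = resolventForm A e z) :
    (fun z : ℂ => m z - (-1 / z - inner ℂ e (A e) / z ^ 2)) =O[Bornology.cobounded ℂ]
      fun z : ℂ => 1 / z ^ 3 := by
  refine IsBigO.of_bound (2 * ‖A (A e)‖) ?_
  -- In this range `‖z‖ - ‖A‖ ≥ ‖z‖ / 2`, which is where the factor 2 in the bound comes from.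
  have hlarge : ∀ᶠ z : ℂ in Bornology.cobounded ℂ, 2 * ‖A‖ + 1 ≤ ‖z‖ :=
    tendsto_norm_cobounded_atTop.eventually_ge_atTop _
  filter_upwards [hm, hlarge] with z ⟨hz, hmz⟩ hlz
  have hz0 : 0 < ‖z‖ := by have := norm_nonneg A; linarith
  have hzne : z ≠ 0 := norm_pos_iff.1 hz0
  obtain ⟨R, hR1, hR2, hR⟩ := exists_inverse_of_mem_resolventSet hz
  -- Two steps of the Neumann expansion with exact remainder; the last resolvent supplies the third
  -- power of `1/z`.
  have hid : R e = (-1 / z) • e - (1 / z ^ 2) • A e + (1 / z ^ 2) • R (A (A e)) := by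
    have h1 : ∀ y, R (A y) = y + z • R y := by
      intro y
      have := hR1 y
      rw [map_sub, map_smul] at this
      exact sub_eq_iff_eq_add.1 this
    have h2 : R (A (A e)) = A e + z • (e + z • R e) := by rw [h1, h1]
    rw [h2]
    match_scalars <;> field_simp <;> ring
  have hval : m z - (-1 / z - inner ℂ e (A e) / z ^ 2) = inner ℂ e (R (A (A e))) / z ^ 2 := by
    rw [hmz, resolventForm, hR, hid]
    simp only [inner_add_right, inner_sub_right, inner_smul_right, inner_self_eq_norm_sq_to_K, he]
    simp
    ring
  rw [hval, norm_div, norm_div, norm_pow, norm_pow, norm_one]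
  have h3 := norm_sub_mul_norm_resolvent_le (hR2 (A (A e)))
  have h4 : ‖inner ℂ e (R (A (A e)))‖ ≤ ‖R (A (A e))‖ := by
    simpa [he] using norm_inner_le_norm (𝕜 := ℂ) e (R (A (A e)))
  have h5 : ‖z‖ * ‖R (A (A e))‖ ≤ 2 * ‖A (A e)‖ := by
    nlinarith [norm_nonneg (R (A (A e)))]
  rw [mul_one_div, div_le_div_iff₀ (by positivity) (by positivity)]
  calc _ ≤ ‖R (A (A e))‖ * ‖z‖ ^ 3 := by gcongr
    _ = (‖z‖ * ‖R (A (A e))‖) * ‖z‖ ^ 2 := by ring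
    _ ≤ _ := by gcongr

variable [CompleteSpace H]

lemma adjoint_apply_eq_sub_imPart (A : H →L[ℂ] H) (x : H) :
    A x = ContinuousLinearMap.adjoint A x + (2 * Complex.I) • imPart A x := by
  have : (2 * Complex.I) ≠ 0 := by simp
  have h : imPart A x = (2 * Complex.I)⁻¹ • (A x - ContinuousLinearMap.adjoint A x) := rfl
  rw [h, smul_inv_smul₀ this]
  abel

lemma sub_adjoint_apply (A : H →L[ℂ] H) (x : H) :
    (A - ContinuousLinearMap.adjoint A) x = (2 * Complex.I) • imPart A x := by
  rw [sub_apply, adjoint_apply_eq_sub_imPart A x]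
  simp

/-- A rank one imaginary part is `Im (A e, e) (·, e) e` for any unit vector `e` in its range. -/
lemma imPart_eq_of_rankOne {A : H →L[ℂ] H} (hA : IsDissipative A) (hr : HasRankOneImPart A)
    {e : H} (he : ‖e‖ = 1)
    (hmem : e ∈ LinearMap.range ((A - ContinuousLinearMap.adjoint A : H →L[ℂ] H) : H →ₗ[ℂ] H)) :
    0 < (inner ℂ e (A e)).im ∧
      ∀ h, imPart A h = (((inner ℂ e (A e)).im : ℂ) * inner ℂ e h) • e := by
  have he0 : e ≠ 0 := by rintro rfl; simp at he
  have hee : inner ℂ e e = (1 : ℂ) := by rw [inner_self_eq_norm_sq_to_K, he]; simp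
  have hmem' : e ∈ LinearMap.range (imPart A : H →ₗ[ℂ] H) := by
    obtain ⟨x, hx⟩ := hmem
    refine ⟨(2 * Complex.I) • x, ?_⟩
    rw [← hx]
    change imPart A ((2 * Complex.I) • x) = (A - ContinuousLinearMap.adjoint A) x
    rw [sub_adjoint_apply, map_smul]
  have hspan : ∀ h, ∃ c : ℂ, imPart A h = c • e := by
    intro h
    obtain ⟨c, hc⟩ := (finrank_eq_one_iff_of_nonzero'
      (⟨e, hmem'⟩ : LinearMap.range (imPart A : H →ₗ[ℂ] H))
      (by simpa [Subtype.ext_iff] using he0)).1 hr ⟨imPart A h, ⟨h, rfl⟩⟩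
    exact ⟨c, (congrArg Subtype.val hc).symm⟩
  have hsymm : ∀ x y, inner ℂ (imPart A x) y = inner ℂ x (imPart A y) := hA.isSymmetric
  obtain ⟨κ, hκ⟩ := hspan e
  have hκ' : inner ℂ e (imPart A e) = κ := by rw [hκ, inner_smul_right, hee, mul_one]
  have hpos : (0 : ℂ) ≤ κ := by
    rw [← hκ']
    have := hA.inner_nonneg_right e
    exact this
  have hκre : ((κ.re : ℝ) : ℂ) = κ := by
    apply Complex.ext <;> simp [(Complex.nonneg_iff.1 hpos).2]
  have hall : ∀ h, imPart A h = (κ * inner ℂ e h) • e := by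
    intro h
    obtain ⟨c, hc⟩ := hspan h
    have h1 : inner ℂ e (imPart A h) = c := by rw [hc, inner_smul_right, hee, mul_one]
    rw [← hsymm, hκ, inner_smul_left] at h1
    rw [hc, ← h1, ← hκre]
    simp
  have him : (inner ℂ e (A e)).im = κ.re := by
    have h1 : inner ℂ e (A e) = conj (inner ℂ e (A e)) + 2 * Complex.I * κ := by
      conv_lhs => rw [adjoint_apply_eq_sub_imPart A e]
      rw [inner_add_right, ContinuousLinearMap.adjoint_inner_right, inner_smul_right, hκ',
        inner_conj_symm]
    have h2 := congrArg Complex.im h1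
    simp only [Complex.add_im, Complex.conj_im, Complex.mul_im, Complex.mul_re, Complex.I_re,
      Complex.I_im, Complex.re_ofNat, Complex.im_ofNat] at h2
    linarith
  rw [him, hκre]
  refine ⟨lt_of_le_of_ne (Complex.nonneg_iff.1 hpos).1 fun h0 => he0 ?_, hall⟩
  have hκ0 : κ = 0 := by rw [← hκre, ← h0]; simp
  obtain ⟨x, hx⟩ := hmem'
  rw [← hx]
  change imPart A x = 0
  rw [hall, hκ0]; simp

/-- With `b = (Ae, e)` one has `2 A_I = 2 Im b (·, e) e`, so `g = √(2 Im b) e` is a channel vector,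
and its resolvent form is `2 Im b` times that of `e`. -/
lemma weylFunction_imp_characteristicFunction {A : H →L[ℂ] H} (hA : IsDissipative A)
    (hr : HasRankOneImPart A) {D : Set ℂ} (hD : Bornology.IsBounded D) {M : ℂ → ℂ}
    (hM : IsWeylFunctionOn A M Dᶜ) :
    ∃ b : ℂ, HasWeylExpansion M b ∧
      IsCharacteristicFunctionOn A (fun z => 1 - 2 * Complex.I * (b.im : ℂ) * M z) Dᶜ := by
  obtain ⟨e, hmem, he, hU⟩ := hM
  obtain ⟨hpos, him⟩ := imPart_eq_of_rankOne hA hr he hmem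
  set b := inner ℂ e (A e) with hb
  have hs : ((√(2 * b.im) : ℝ) : ℂ) * ((√(2 * b.im) : ℝ) : ℂ) = 2 * (b.im : ℂ) := by
    rw [← Complex.ofReal_mul, Real.mul_self_sqrt (by positivity)]; simp
  refine ⟨b, ⟨hpos, resolventForm_expansion A he ?_⟩, ((√(2 * b.im) : ℝ) : ℂ) • e, ?_, ?_⟩
  · filter_upwards [Bornology.isBounded_def.1 hD] with z hz using hU z hz
  · intro h
    rw [him, inner_smul_left, smul_smul, smul_smul, Complex.conj_ofReal]
    congr 1
    rw [mul_right_comm, hs]; ring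
  · intro z hz
    refine ⟨(hU z hz).1, ?_⟩
    simp only [resolventForm, map_smul, inner_smul_left, inner_smul_right, Complex.conj_ofReal]
    rw [(hU z hz).2, resolventForm, ← mul_assoc (_ : ℂ) _ (inner ℂ e _), hs]
    ring

/-- With `R(z) = (A - z)⁻¹`, the kernel at `(z, ξ)` is `(R(ξ)* g, R(z)* g) / (2 Im b)`. The
quadratic form is thus a squared norm divided by `2 Im b`. -/
lemma nonnegativeKernel_of_characteristicFunction {A : H →L[ℂ] H} {U : Set ℂ} {M : ℂ → ℂ} {b : ℂ}
    (hb : 0 < b.im)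
    (hW : IsCharacteristicFunctionOn A (fun z => 1 - 2 * Complex.I * (b.im : ℂ) * M z) U) :
    IsNonnegativeKernelOn (weylKernel M b) U := by
  obtain ⟨g, hg, hU⟩ := hW
  have hb0 : (b.im : ℂ) ≠ 0 := by exact_mod_cast hb.ne'
  intro n z c hz hne
  choose R hR1 hR2 hR using fun i => exists_inverse_of_mem_resolventSet (hU (z i) (hz i)).1
  have hM : ∀ i, M (z i) = inner ℂ g (R i g) / (2 * b.im) := by
    intro i
    have h1 := (hU (z i) (hz i)).2
    simp only [resolventForm, hR] at h1
    rw [eq_div_iff (by simpa using hb0)]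
    have h2 : Complex.I * (M (z i) * (2 * b.im)) = Complex.I * inner ℂ g (R i g) := by
      linear_combination -h1
    exact mul_left_cancel₀ Complex.I_ne_zero h2
  have key : ∀ i j, weylKernel M b (z j) (z i) =
      inner ℂ (ContinuousLinearMap.adjoint (R j) g) (ContinuousLinearMap.adjoint (R i) g)
        / (2 * b.im) := by
    intro i j
    have hd : z j - conj (z i) ≠ 0 := sub_ne_zero.2 (hne j i)
    set y := ContinuousLinearMap.adjoint (R i) g with hy
    have h1 : ContinuousLinearMap.adjoint A y - conj (z i) • y = g := by
      apply ext_inner_right ℂ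
      intro v
      rw [inner_sub_left, ContinuousLinearMap.adjoint_inner_left, inner_smul_left, Complex.conj_conj,
        hy, ContinuousLinearMap.adjoint_inner_left, ContinuousLinearMap.adjoint_inner_left,
        ← inner_smul_right, ← inner_sub_right, ← map_smul, ← map_sub, hR1]
    -- The channel relation reads `A = A* + i (·, g) g`. Inserting it into `y = R_j (A - z_j) y` and
    -- pairing with `g` relates the product of `R_j` and `R_i*` to the two resolvent forms.
    have h2 : A y = conj (z i) • y + g + (Complex.I * inner ℂ g y) • g := by
      rw [adjoint_apply_eq_sub_imPart A y]
      have h3 := hg y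
      have h4 : (2 * Complex.I) • imPart A y = (Complex.I * inner ℂ g y) • g := by
        rw [mul_comm, mul_smul, h3, smul_smul]
      rw [h4, ← h1]; abel
    have h5 : y = R j (A y - z j • y) := (hR1 j y).symm
    have h6 : inner ℂ g y = conj (inner ℂ g (R i g)) := by
      rw [hy, ContinuousLinearMap.adjoint_inner_right, inner_conj_symm]
    have h7 : inner ℂ g y = (conj (z i) - z j) * inner ℂ g (R j y) + inner ℂ g (R j g)
        + Complex.I * inner ℂ g y * inner ℂ g (R j g) := by
      conv_lhs => rw [h5, h2]
      simp only [map_add, map_sub, map_smul, inner_add_right, inner_sub_right, inner_smul_right]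
      ring
    rw [ContinuousLinearMap.adjoint_inner_left, weylKernel, div_eq_div_iff hd (by simpa using hb0),
      hM, hM]
    rw [h6] at h7
    simp only [map_div₀, map_mul, Complex.conj_ofReal, map_ofNat]
    field_simp
    linear_combination -h7
  have hsum : ∑ i, ∑ j, c i * conj (c j) * weylKernel M b (z j) (z i) =
      inner ℂ (∑ j, c j • ContinuousLinearMap.adjoint (R j) g)
        (∑ i, c i • ContinuousLinearMap.adjoint (R i) g) / ((2 * b.im : ℝ) : ℂ) := by
    rw [inner_sum, Finset.sum_div]
    refine Finset.sum_congr rfl fun i _ => ?_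
    rw [sum_inner, Finset.sum_div]
    refine Finset.sum_congr rfl fun j _ => ?_
    rw [key, inner_smul_left, inner_smul_right]
    push_cast
    ring
  rw [hsum, inner_self_eq_norm_sq_to_K]
  have : (0 : ℝ) ≤ ‖∑ i, c i • ContinuousLinearMap.adjoint (R i) g‖ ^ 2 / (2 * b.im) := by
    positivity
  have h' : (0 : ℂ) ≤ ((‖∑ i, c i • ContinuousLinearMap.adjoint (R i) g‖ ^ 2 / (2 * b.im) : ℝ) : ℂ) :=
    Complex.zero_le_real.2 this
  simpa using h'

end ResolventForms

/-! ### Rank one perturbations: cyclic subspaces and resolvents. -/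

section RankOnePerturbation

variable {H : Type*} [NormedAddCommGroup H] [InnerProductSpace ℂ H]

/-- If `T - B` has range in the span of `e`, then the span of the orbit of `e` under `B` is
contained in the span of the orbit under `T`. -/
lemma span_orbit_le_of_rankOne_perturbation {B T : H →L[ℂ] H} {e : H}
    (h : ∀ x, ∃ c : ℂ, B x = T x + c • e) :
    Submodule.span ℂ (Set.range fun n : ℕ => (B ^ n) e) ≤
      Submodule.span ℂ (Set.range fun n : ℕ => (T ^ n) e) := by
  set V := Submodule.span ℂ (Set.range fun n : ℕ => (T ^ n) e) with hV
  have heV : e ∈ V := Submodule.subset_span ⟨0, by simp⟩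
  have hTV : ∀ v ∈ V, T v ∈ V := by
    intro v hv
    induction hv using Submodule.span_induction with
    | mem x hx =>
      obtain ⟨n, rfl⟩ := hx
      exact Submodule.subset_span ⟨n + 1, by simp [pow_succ']⟩
    | zero => simp
    | add x y _ _ hx hy => rw [map_add]; exact V.add_mem hx hy
    | smul c x _ hx => rw [map_smul]; exact V.smul_mem c hx
  rw [Submodule.span_le]
  rintro _ ⟨n, rfl⟩
  induction n with
  | zero => simpa using heV
  | succ n ih =>
    obtain ⟨c, hc⟩ := h ((B ^ n) e)
    change (B ^ (n + 1)) e ∈ V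
    rw [pow_succ', mul_apply_eq_comp, hc]
    exact V.add_mem (hTV _ ih) (V.smul_mem c heV)

lemma separableSpace_of_cyclic {B : H →L[ℂ] H} {e : H}
    (h : (Submodule.span ℂ (Set.range fun n : ℕ => (B ^ n) e)).topologicalClosure = ⊤) :
    TopologicalSpace.SeparableSpace H := by
  rw [← TopologicalSpace.isSeparable_univ_iff]
  have h1 : TopologicalSpace.IsSeparable
      (Submodule.span ℂ (Set.range fun n : ℕ => (B ^ n) e) : Set H) :=
    (Set.countable_range _).isSeparable.span
  have h2 := h1.closure
  rwa [← Submodule.topologicalClosure_coe, h] at h2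

/-- The resolvent of a rank one perturbation `A = B + t (·, e) e`. -/
lemma resolvent_rankOne_perturbation {A B R : H →L[ℂ] H} {e : H} {t z : ℂ}
    (hA : ∀ x, A x = B x + (t * inner ℂ e x) • e)
    (hR1 : ∀ x, R (B x - z • x) = x) (hR2 : ∀ x, B (R x) - z • R x = x)
    (hd : 1 + t * inner ℂ e (R e) ≠ 0) :
    ∃ S : H →L[ℂ] H, (∀ x, S (A x - z • x) = x) ∧ (∀ x, A (S x) - z • S x = x) ∧
      ∀ x, S x = R x - (t / (1 + t * inner ℂ e (R e)) * inner ℂ e (R x)) • R e := by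
  set d := 1 + t * inner ℂ e (R e) with hdd
  -- The Sherman–Morrison formula; `d` is the perturbation determinant.
  let S : H →L[ℂ] H := R - (t / d) • ((innerSL ℂ e).comp R).smulRight (R e)
  have hS : ∀ x, S x = R x - (t / d * inner ℂ e (R x)) • R e := by
    intro x
    simp [S, smul_smul]
  refine ⟨S, fun x => ?_, fun x => ?_, hS⟩
  · have h1 : A x - z • x = (B x - z • x) + (t * inner ℂ e x) • e := by rw [hA]; abel
    rw [hS, h1, map_add, map_smul, hR1, inner_add_right, inner_smul_right]
    match_scalars
    · ring
    · field_simp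
      rw [hdd]; ring
  · have h1 : ∀ y, B (R y) = y + z • R y := fun y => sub_eq_iff_eq_add.1 (hR2 y)
    rw [hS, map_sub, map_smul, hA, hA, h1, h1]
    match_scalars
    · ring
    · ring
    · field_simp
      rw [hdd]; ring
    · ring

end RankOnePerturbation

/-! ### Regular real points from holomorphic continuation of the resolvent form. -/

section Continuation

variable {H : Type*} [NormedAddCommGroup H] [InnerProductSpace ℂ H] [CompleteSpace H]

/-- The form `((A - z)⁻¹ h, k)` continues holomorphically where `((A - z)⁻¹ e, e)` does, for
`h` and `k` in the spans of the orbits of `e` under `A` and `A*`. -/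
lemma exists_holomorphic_resolvent_form {A : H →L[ℂ] H} {e : H} {V N : Set ℂ} {M : ℂ → ℂ}
    (hM : DifferentiableOn ℂ M V) {R : ℂ → H →L[ℂ] H}
    (hR1 : ∀ z ∈ N, ∀ x, R z (A x - z • x) = x) (hR2 : ∀ z ∈ N, ∀ x, A (R z x) - z • R z x = x)
    (hMR : ∀ z ∈ N, M z = inner ℂ e (R z e)) {h k : H}
    (hh : h ∈ Submodule.span ℂ (Set.range fun n : ℕ => (A ^ n) e))
    (hk : k ∈ Submodule.span ℂ
      (Set.range fun n : ℕ => (ContinuousLinearMap.adjoint A ^ n) e)) :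
    ∃ φ : ℂ → ℂ, DifferentiableOn ℂ φ V ∧ ∀ z ∈ N, φ z = inner ℂ k (R z h) := by
  -- Since `R A = 1 + z R` and `A R = 1 + z R`, each further power of `A` on the right, or of `A*`
  -- on the left, replaces `φ` by a constant plus `z φ`.
  have hpow : ∀ n m : ℕ, ∃ φ : ℂ → ℂ, DifferentiableOn ℂ φ V ∧
      ∀ z ∈ N, φ z = inner ℂ ((ContinuousLinearMap.adjoint A ^ n) e) (R z ((A ^ m) e)) := by
    intro n
    induction n with
    | zero =>
      intro m
      induction m with
      | zero => exact ⟨M, hM, by simpa using hMR⟩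
      | succ m ih =>
        obtain ⟨φ, hφ, hφN⟩ := ih
        refine ⟨fun z => inner ℂ e ((A ^ m) e) + z * φ z,
          (differentiableOn_const _).add (differentiableOn_id.mul hφ), fun z hz => ?_⟩
        have h1 := hR1 z hz ((A ^ m) e)
        rw [map_sub, map_smul, sub_eq_iff_eq_add] at h1
        dsimp only
        rw [pow_succ' A, mul_apply_eq_comp, h1, hφN z hz, inner_add_right,
          inner_smul_right]
        simp
    | succ n ih =>
      intro m
      obtain ⟨φ, hφ, hφN⟩ := ih m
      refine ⟨fun z => inner ℂ ((ContinuousLinearMap.adjoint A ^ n) e) ((A ^ m) e) + z * φ z,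
        (differentiableOn_const _).add (differentiableOn_id.mul hφ), fun z hz => ?_⟩
      have h1 := hR2 z hz ((A ^ m) e)
      rw [sub_eq_iff_eq_add] at h1
      dsimp only
      rw [pow_succ', mul_apply_eq_comp, ContinuousLinearMap.adjoint_inner_left, h1,
        hφN z hz, inner_add_right, inner_smul_right]
  have hleft : ∀ m : ℕ, ∃ φ : ℂ → ℂ, DifferentiableOn ℂ φ V ∧
      ∀ z ∈ N, φ z = inner ℂ k (R z ((A ^ m) e)) := by
    intro m
    induction hk using Submodule.span_induction with
    | mem x hx =>
      obtain ⟨n, rfl⟩ := hx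
      exact hpow n m
    | zero => exact ⟨0, differentiableOn_const _, by simp⟩
    | add x y _ _ hx hy =>
      obtain ⟨φ, hφ, hφN⟩ := hx
      obtain ⟨ψ, hψ, hψN⟩ := hy
      exact ⟨fun z => φ z + ψ z, hφ.add hψ, fun z hz => by
        rw [inner_add_left, ← hφN z hz, ← hψN z hz]⟩
    | smul c x _ hx =>
      obtain ⟨φ, hφ, hφN⟩ := hx
      exact ⟨fun z => conj c * φ z, (differentiableOn_const _).mul hφ, fun z hz => by
        rw [inner_smul_left, ← hφN z hz]⟩
  induction hh using Submodule.span_induction with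
  | mem x hx =>
    obtain ⟨n, rfl⟩ := hx
    exact hleft n
  | zero => exact ⟨0, differentiableOn_const _, by simp⟩
  | add x y _ _ hx hy =>
    obtain ⟨φ, hφ, hφN⟩ := hx
    obtain ⟨ψ, hψ, hψN⟩ := hy
    exact ⟨fun z => φ z + ψ z, hφ.add hψ, fun z hz => by
      rw [map_add, inner_add_right, ← hφN z hz, ← hψN z hz]⟩
  | smul c x _ hx =>
    obtain ⟨φ, hφ, hφN⟩ := hx
    exact ⟨fun z => c * φ z, (differentiableOn_const _).mul hφ, fun z hz => by
      rw [map_smul, inner_smul_right, ← hφN z hz]⟩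

/-- A maximum principle for functions with a singularity of order two along the real axis. -/
lemma norm_le_of_norm_le_div_im_sq {φ : ℂ → ℂ} {x δ C : ℝ} (hδ : 0 < δ) (hC : 0 ≤ C)
    (hφ : DifferentiableOn ℂ φ (Metric.closedBall (x : ℂ) δ))
    (hb : ∀ z ∈ Metric.closedBall (x : ℂ) δ, z.im ≠ 0 → ‖φ z‖ * z.im ^ 2 ≤ C)
    {η : ℝ} (hη : |η| ≤ δ) : ‖φ (x + η * Complex.I)‖ ≤ 4 * C / δ ^ 2 := by
  -- On the circle `|z - x| = δ` one has `(z - x)² - δ² = 2i Im z (z - x)`, so the square of this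
  -- factor absorbs `(Im z)⁻²` and leaves the bound `4δ²C`. On the vertical diameter the multiplier
  -- has modulus `(η² + δ²)² ≥ δ⁴`.
  set ψ : ℂ → ℂ := fun z => ((z - x) ^ 2 - δ ^ 2) ^ 2 * φ z with hψ
  have hψd : DiffContOnCl ℂ ψ (Metric.ball (x : ℂ) δ) := by
    apply DifferentiableOn.diffContOnCl
    rw [closure_ball _ hδ.ne']
    exact (by fun_prop : DifferentiableOn ℂ (fun z : ℂ => ((z - x) ^ 2 - (δ : ℂ) ^ 2) ^ 2)
      (Metric.closedBall (x : ℂ) δ)).mul hφ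
  have hfr : ∀ z ∈ frontier (Metric.ball (x : ℂ) δ), ‖ψ z‖ ≤ 4 * δ ^ 2 * C := by
    intro z hz
    rw [frontier_ball _ hδ.ne'] at hz
    have hz' : ‖z - x‖ = δ := by simpa [dist_eq_norm] using hz
    have h1 : ((z - x) ^ 2 - (δ : ℂ) ^ 2) = 2 * Complex.I * z.im * (z - x) := by
      have h2 : (z - x) * conj (z - x) = (δ : ℂ) ^ 2 := by
        rw [Complex.mul_conj, Complex.normSq_eq_norm_sq, hz']; simp
      have h3 : (z - x) - conj (z - x) = 2 * Complex.I * z.im := by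
        apply Complex.ext <;> simp
        ring
      rw [← h2, ← h3]; ring
    have h4 : ‖ψ z‖ = 4 * δ ^ 2 * (‖φ z‖ * z.im ^ 2) := by
      simp only [hψ]
      rw [h1, norm_mul, norm_pow, norm_mul, hz']
      simp only [norm_mul, Complex.norm_I, Complex.norm_real, Complex.norm_ofNat]
      rw [mul_pow, mul_pow, Real.norm_eq_abs, sq_abs]
      ring
    rw [h4]
    by_cases hzi : z.im = 0
    · rw [hzi]; simp; positivity
    · have := hb z (Metric.sphere_subset_closedBall hz) hzi
      gcongr
  have hmem : (x : ℂ) + η * Complex.I ∈ closure (Metric.ball (x : ℂ) δ) := by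
    rw [closure_ball _ hδ.ne', Metric.mem_closedBall, dist_eq_norm]
    simpa using hη
  have hmax := Complex.norm_le_of_forall_mem_frontier_norm_le Metric.isBounded_ball hψd hfr hmem
  have h5 : ‖ψ (x + η * Complex.I)‖ = (η ^ 2 + δ ^ 2) ^ 2 * ‖φ (x + η * Complex.I)‖ := by
    simp only [hψ]
    have : ((x : ℂ) + η * Complex.I - x) ^ 2 - (δ : ℂ) ^ 2 = ((-(η ^ 2 + δ ^ 2) : ℝ) : ℂ) := by
      push_cast
      linear_combination (η : ℂ) ^ 2 * Complex.I_sq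
    rw [this, norm_mul, norm_pow, Complex.norm_real, Real.norm_eq_abs, sq_abs]
    ring
  rw [h5] at hmax
  have h6 : δ ^ 4 * ‖φ (x + η * Complex.I)‖ ≤ 4 * δ ^ 2 * C := by
    refine le_trans ?_ hmax
    have : δ ^ 4 ≤ (η ^ 2 + δ ^ 2) ^ 2 := by nlinarith [sq_nonneg η, sq_nonneg δ, sq_nonneg (η * δ)]
    gcongr
  rw [le_div_iff₀ (by positivity)]
  have h7 : δ ^ 2 * (‖φ (x + η * Complex.I)‖ * δ ^ 2) ≤ δ ^ 2 * (4 * C) := by linarith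
  exact le_of_mul_le_mul_left h7 (by positivity)

/-- Let `e` be cyclic for `A` and for `A*`, and let the resolvent of `A` grow at most
quadratically at the real axis near `x`. If `((A - z)⁻¹ e, e)` is holomorphic at `x`, then `x`
lies in the resolvent set. -/
lemma mem_resolventSet_of_holomorphic_form {A : H →L[ℂ] H} {e : H} {x δ C : ℝ} (hδ : 0 < δ)
    {M : ℂ → ℂ} (hM : DifferentiableOn ℂ M (Metric.closedBall (x : ℂ) δ))
    {R : ℂ → H →L[ℂ] H}
    (hR1 : ∀ z ∈ Metric.closedBall (x : ℂ) δ, z.im ≠ 0 → ∀ y, R z (A y - z • y) = y)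
    (hR2 : ∀ z ∈ Metric.closedBall (x : ℂ) δ, z.im ≠ 0 → ∀ y, A (R z y) - z • R z y = y)
    (hMR : ∀ z ∈ Metric.closedBall (x : ℂ) δ, z.im ≠ 0 → M z = inner ℂ e (R z e))
    (hC : ∀ z ∈ Metric.closedBall (x : ℂ) δ, z.im ≠ 0 → ∀ y, ‖R z y‖ * z.im ^ 2 ≤ C * ‖y‖)
    (hC0 : 0 ≤ C)
    (hd : (Submodule.span ℂ (Set.range fun n : ℕ => (A ^ n) e)).topologicalClosure = ⊤)
    (hd' : (Submodule.span ℂ (Set.range fun n : ℕ =>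
      (ContinuousLinearMap.adjoint A ^ n) e)).topologicalClosure = ⊤) :
    (x : ℂ) ∈ resolventSet ℂ A := by
  set K := 4 * C / δ ^ 2 with hK
  have hK0 : 0 ≤ K := by positivity
  have hmem : ∀ η : ℝ, |η| ≤ δ → (x : ℂ) + η * Complex.I ∈ Metric.closedBall (x : ℂ) δ := by
    intro η hη
    rw [Metric.mem_closedBall, dist_eq_norm]
    simpa using hη
  -- The point is that `K` does not depend on `η`. The maximum principle gives the bound on the
  -- orbit spans, and density extends it to all vectors.
  have hbound : ∀ η : ℝ, 0 < η → η ≤ δ → ∀ h k : H,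
      ‖inner ℂ k (R (x + η * Complex.I) h)‖ ≤ K * ‖h‖ * ‖k‖ := by
    intro η hη hηδ
    have hηa : |η| ≤ δ := by rwa [abs_of_pos hη]
    have hz := hmem η hηa
    have hzi : ((x : ℂ) + η * Complex.I).im ≠ 0 := by simpa using hη.ne'
    have hdense : ∀ h ∈ Submodule.span ℂ (Set.range fun n : ℕ => (A ^ n) e),
        ∀ k ∈ Submodule.span ℂ (Set.range fun n : ℕ => (ContinuousLinearMap.adjoint A ^ n) e),
        ‖inner ℂ k (R (x + η * Complex.I) h)‖ ≤ K * ‖h‖ * ‖k‖ := by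
      intro h hh k hk
      obtain ⟨φ, hφ, hφN⟩ := exists_holomorphic_resolvent_form
        (N := {z | z ∈ Metric.closedBall (x : ℂ) δ ∧ z.im ≠ 0}) hM
        (fun z hz => hR1 z hz.1 hz.2) (fun z hz => hR2 z hz.1 hz.2)
        (fun z hz => hMR z hz.1 hz.2) hh hk
      rw [← hφN _ ⟨hz, hzi⟩]
      have := norm_le_of_norm_le_div_im_sq (C := C * ‖h‖ * ‖k‖) hδ (by positivity) hφ
        (fun z hz hzi => ?_) hηa
      · refine this.trans (le_of_eq ?_)
        rw [hK]; ring
      · rw [hφN z ⟨hz, hzi⟩]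
        calc _ ≤ ‖k‖ * ‖R z h‖ * z.im ^ 2 := by gcongr; exact norm_inner_le_norm _ _
          _ = ‖k‖ * (‖R z h‖ * z.im ^ 2) := by ring
          _ ≤ ‖k‖ * (C * ‖h‖) := mul_le_mul_of_nonneg_left (hC z hz hzi h) (norm_nonneg k)
          _ = _ := by ring
    have hstep : ∀ h ∈ Submodule.span ℂ (Set.range fun n : ℕ => (A ^ n) e), ∀ k : H,
        ‖inner ℂ k (R (x + η * Complex.I) h)‖ ≤ K * ‖h‖ * ‖k‖ := by
      intro h hh k
      have hk : k ∈ closure (Submodule.span ℂ (Set.range fun n : ℕ =>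
          (ContinuousLinearMap.adjoint A ^ n) e) : Set H) := by
        rw [← Submodule.topologicalClosure_coe, hd']; trivial
      exact closure_minimal (t := {k | ‖inner ℂ k (R (x + η * Complex.I) h)‖ ≤ K * ‖h‖ * ‖k‖})
        (fun k hk => hdense h hh k hk) (isClosed_le (by fun_prop) (by fun_prop)) hk
    intro h k
    have hh : h ∈ closure (Submodule.span ℂ (Set.range fun n : ℕ => (A ^ n) e) : Set H) := by
      rw [← Submodule.topologicalClosure_coe, hd]; trivial
    exact closure_minimal (t := {h | ‖inner ℂ k (R (x + η * Complex.I) h)‖ ≤ K * ‖h‖ * ‖k‖})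
      (fun h hh => hstep h hh k) (isClosed_le (by fun_prop) (by fun_prop)) hh
  -- Small enough that `η K < 1`, so that the Neumann series inverts `1 + (z - x) R z`.
  set η : ℝ := min δ (1 / (2 * (K + 1))) with hη
  have hη0 : 0 < η := lt_min hδ (by positivity)
  have hηδ : η ≤ δ := min_le_left _ _
  set z : ℂ := x + η * Complex.I with hz
  have hzm : z ∈ Metric.closedBall (x : ℂ) δ := hmem η (by rwa [abs_of_pos hη0])
  have hzi : z.im ≠ 0 := by simpa [hz] using hη0.ne'
  have hRK : ‖R z‖ ≤ K := by
    refine ContinuousLinearMap.opNorm_le_bound _ hK0 fun y => ?_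
    have h1 := hbound η hη0 hηδ y (R z y)
    rw [inner_self_eq_norm_sq_to_K, norm_pow] at h1
    simp only [RCLike.norm_ofReal, abs_norm] at h1
    by_cases h0 : ‖R z y‖ = 0
    · rw [h0]; positivity
    · have h2 : 0 < ‖R z y‖ := lt_of_le_of_ne (norm_nonneg _) (Ne.symm h0)
      nlinarith
  have hsmall : ‖((z - x) • R z : H →L[ℂ] H)‖ < 1 := by
    have h1 : ‖z - x‖ = η := by simp [hz, abs_of_pos hη0]
    rw [norm_smul, h1]
    have h2 : η ≤ 1 / (2 * (K + 1)) := min_le_right _ _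
    rw [le_div_iff₀ (by positivity)] at h2
    nlinarith [norm_nonneg (R z)]
  have hu : IsUnit (1 + (z - x) • R z : H →L[ℂ] H) := by
    have h1 := (Units.oneSub (-((z - x) • R z) : H →L[ℂ] H) (by rwa [norm_neg])).isUnit
    rwa [Units.val_oneSub, sub_neg_eq_add] at h1
  have hAz := (mem_resolventSet_iff_isUnit_sub A z).1
    (mem_resolventSet_of_inverse (hR1 z hzm hzi) (hR2 z hzm hzi)).1
  rw [mem_resolventSet_iff_isUnit_sub]
  have heq : A - algebraMap ℂ (H →L[ℂ] H) x =
      (A - algebraMap ℂ (H →L[ℂ] H) z) * (1 + (z - x) • R z : H →L[ℂ] H) := by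
    ext y
    have h1 : A (R z y) = y + z • R z y := sub_eq_iff_eq_add.1 (hR2 z hzm hzi y)
    simp only [Algebra.algebraMap_eq_smul_one, sub_apply, smul_apply,
      one_apply_eq_self, mul_apply_eq_comp, add_apply, map_add, map_smul,
      h1]
    match_scalars <;> ring
  rw [heq]
  exact hAz.mul hu

end Continuation

/-! ### The model operator `A = B + iβ (·, e) e`. -/

section Model

variable {H : Type*} [NormedAddCommGroup H] [InnerProductSpace ℂ H] [CompleteSpace H]

/-- Since `(By, y)` is real, the imaginary part of `((B - z)y, y)` is `-Im z ‖y‖²`; Cauchy–Schwarz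
does the rest. -/
lemma norm_mul_abs_im_le_of_selfAdjoint {B : H →L[ℂ] H}
    (hB : ContinuousLinearMap.adjoint B = B) {z : ℂ} {x y : H} (h : B y - z • y = x) :
    ‖y‖ * |z.im| ≤ ‖x‖ := by
  have h1 : (inner ℂ y (B y)).im = 0 := by
    have h2 : conj (inner ℂ y (B y)) = inner ℂ y (B y) := by
      rw [inner_conj_symm]
      conv_rhs => rw [← ContinuousLinearMap.adjoint_inner_left, hB]
    exact Complex.conj_eq_iff_im.1 h2
  have h3 : (inner ℂ y x).im = -(z.im * ‖y‖ ^ 2) := by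
    have hyy : inner ℂ y y = ((‖y‖ ^ 2 : ℝ) : ℂ) := by
      rw [inner_self_eq_norm_sq_to_K]; push_cast; rfl
    rw [← h, inner_sub_right, inner_smul_right, hyy, Complex.sub_im, h1, Complex.im_mul_ofReal]
    ring
  have h4 : |z.im| * ‖y‖ ^ 2 ≤ ‖y‖ * ‖x‖ := by
    calc |z.im| * ‖y‖ ^ 2 = |(inner ℂ y x).im| := by rw [h3, abs_neg, abs_mul, abs_sq]
      _ ≤ ‖inner ℂ y x‖ := Complex.abs_im_le_norm _
      _ ≤ _ := norm_inner_le_norm _ _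
  by_cases h0 : ‖y‖ = 0
  · rw [h0, zero_mul]; exact norm_nonneg _
  · have : 0 < ‖y‖ := lt_of_le_of_ne (norm_nonneg _) (Ne.symm h0)
    refine le_of_mul_le_mul_left ?_ this
    linarith

/-- On a reducing subspace where `A` is self-adjoint, `A - A*` vanishes, so the subspace is
orthogonal to `e`. Being invariant under `A`, it is then orthogonal to the whole orbit of `e` under
`A*`. -/
lemma isPrimeOperator_of_cyclic_adjoint {A : H →L[ℂ] H} {e : H} {β : ℝ} (hβ : 0 < β)
    (him : ∀ x, imPart A x = ((β : ℂ) * inner ℂ e x) • e)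
    (hd : (Submodule.span ℂ (Set.range fun n : ℕ =>
      (ContinuousLinearMap.adjoint A ^ n) e)).topologicalClosure = ⊤) :
    IsPrimeOperator A := by
  intro S hS hAS hAS' hself
  have : CompleteSpace S := hS.completeSpace_coe
  have hSS : Sᗮᗮ = S := Submodule.orthogonal_orthogonal S
  have hadjS : ∀ x ∈ S, ContinuousLinearMap.adjoint A x ∈ S := by
    intro x hx
    rw [← hSS, Submodule.mem_orthogonal]
    intro u hu
    rw [ContinuousLinearMap.adjoint_inner_right]
    exact (Submodule.mem_orthogonal' _ _).1 (hAS' u hu) x hx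
  have heS : ∀ x ∈ S, inner ℂ e x = 0 := by
    intro x hx
    have h1 : A x - ContinuousLinearMap.adjoint A x ∈ S := S.sub_mem (hAS x hx) (hadjS x hx)
    have h2 : A x - ContinuousLinearMap.adjoint A x = 0 := by
      rw [← inner_self_eq_zero (𝕜 := ℂ), inner_sub_left, hself x hx _ h1,
        ContinuousLinearMap.adjoint_inner_left, sub_self]
    have h3 := adjoint_apply_eq_sub_imPart A x
    rw [← sub_eq_iff_eq_add', h2, him] at h3
    have h4 : (2 * Complex.I * (β * inner ℂ e x)) • e = 0 := by rw [mul_smul]; exact h3.symm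
    rcases smul_eq_zero.1 h4 with h5 | h5
    · have : (β : ℂ) ≠ 0 := by exact_mod_cast hβ.ne'
      simpa [this] using h5
    · rw [h5, inner_zero_left]
  rw [Submodule.eq_bot_iff]
  intro x hx
  have hpow : ∀ n : ℕ, ∀ y ∈ S, inner ℂ ((ContinuousLinearMap.adjoint A ^ n) e) y = 0 := by
    intro n
    induction n with
    | zero => simpa using heS
    | succ n ih =>
      intro y hy
      rw [pow_succ', mul_apply_eq_comp, ContinuousLinearMap.adjoint_inner_left]
      exact ih _ (hAS y hy)
  have hx' : x ∈ (Submodule.span ℂ (Set.range fun n : ℕ =>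
      (ContinuousLinearMap.adjoint A ^ n) e))ᗮ := by
    rw [Submodule.mem_orthogonal]
    intro u hu
    induction hu using Submodule.span_induction with
    | mem u hu =>
      obtain ⟨n, rfl⟩ := hu
      exact hpow n x hx
    | zero => simp
    | add u v _ _ hu hv => rw [inner_add_left, hu, hv, add_zero]
    | smul c u _ hu => rw [inner_smul_left, hu, mul_zero]
  rw [← Submodule.orthogonal_closure, hd, Submodule.top_orthogonal_eq_bot] at hx'
  simpa using hx'

/-- A dissipative rank one perturbation of a self-adjoint operator with a cyclic vector. -/
lemma exists_prime_dissipative_of_selfAdjoint {B : H →L[ℂ] H}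
    (hB : ContinuousLinearMap.adjoint B = B) {e : H} (he : ‖e‖ = 1)
    (hcyc : (Submodule.span ℂ (Set.range fun n : ℕ => (B ^ n) e)).topologicalClosure = ⊤)
    {β : ℝ} (hβ : 0 < β) {D : Set ℂ} (hD : IsClosed D) {M : ℂ → ℂ}
    (hM : DifferentiableOn ℂ M Dᶜ)
    (hQ : ∀ z ∈ Dᶜ, z.im ≠ 0 → z ∈ resolventSet ℂ B ∧ Complex.I + β * M z ≠ 0 ∧
      resolventForm B e z = Complex.I * M z / (Complex.I + β * M z)) :
    ∃ A : H →L[ℂ] H, IsPrimeOperator A ∧ IsDissipative A ∧ HasRankOneImPart A ∧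
      IsWeylFunctionOn A M Dᶜ := by
  have he0 : e ≠ 0 := by rintro rfl; simp at he
  have hee : inner ℂ e e = (1 : ℂ) := by rw [inner_self_eq_norm_sq_to_K, he]; simp
  have hβ0 : (β : ℂ) ≠ 0 := by exact_mod_cast hβ.ne'
  let P : H →L[ℂ] H := (innerSL ℂ e).smulRight e
  have hP : ∀ x, P x = inner ℂ e x • e := fun x => by simp [P]
  have hPadj : ContinuousLinearMap.adjoint P = P := by
    symm
    rw [ContinuousLinearMap.eq_adjoint_iff]
    intro x y
    rw [hP, hP, inner_smul_left, inner_smul_right, inner_conj_symm]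
    ring
  set A : H →L[ℂ] H := B + (β * Complex.I) • P with hAdef
  have hA : ∀ x, A x = B x + (β * Complex.I * inner ℂ e x) • e := by
    intro x
    simp [hAdef, hP, smul_smul]
  have hadj : ∀ x, ContinuousLinearMap.adjoint A x = B x + (-(β * Complex.I) * inner ℂ e x) • e := by
    intro x
    have : ContinuousLinearMap.adjoint A = B + (-(β * Complex.I)) • P := by
      rw [hAdef, map_add, map_smulₛₗ, hB, hPadj]
      simp
    rw [this]
    simp [hP, smul_smul]
  have him : ∀ x, imPart A x = ((β : ℂ) * inner ℂ e x) • e := by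
    intro x
    have h1 : imPart A x = (2 * Complex.I)⁻¹ • (A x - ContinuousLinearMap.adjoint A x) := rfl
    rw [h1, hA, hadj]
    match_scalars
    · ring
    · field_simp
      ring
  have hdA : (Submodule.span ℂ (Set.range fun n : ℕ => (A ^ n) e)).topologicalClosure = ⊤ := by
    rw [eq_top_iff, ← hcyc]
    apply Submodule.topologicalClosure_mono
    apply span_orbit_le_of_rankOne_perturbation
    intro x
    refine ⟨-(β * Complex.I * inner ℂ e x), ?_⟩
    rw [hA]
    module
  have hdA' : (Submodule.span ℂ (Set.range fun n : ℕ =>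
      (ContinuousLinearMap.adjoint A ^ n) e)).topologicalClosure = ⊤ := by
    rw [eq_top_iff, ← hcyc]
    apply Submodule.topologicalClosure_mono
    apply span_orbit_le_of_rankOne_perturbation
    intro x
    refine ⟨β * Complex.I * inner ℂ e x, ?_⟩
    rw [hadj]
    module
  -- With `q = ((B - z)⁻¹e, e) = iM / (i + βM)`, the perturbation determinant `1 + iβq` is the
  -- reciprocal of `1 - iβM`, hence nonzero, and the form of the new resolvent at `e` is `q / (1 +
  -- iβq) = M`. The correction term contains the resolvent of `B` twice, whence the quadratic
  -- growth.
  have hnonreal : ∀ z ∈ Dᶜ, z.im ≠ 0 → ∃ S : H →L[ℂ] H, (∀ x, S (A x - z • x) = x) ∧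
      (∀ x, A (S x) - z • S x = x) ∧ M z = inner ℂ e (S e) ∧
      ∀ x, ‖S x‖ * z.im ^ 2 ≤ (|z.im| + β * ‖1 - Complex.I * β * M z‖) * ‖x‖ := by
    intro z hz hzi
    obtain ⟨hρ, hne, hform⟩ := hQ z hz hzi
    obtain ⟨R, hR1, hR2, hR⟩ := exists_inverse_of_mem_resolventSet hρ
    rw [resolventForm, hR] at hform
    have hd : (1 + β * Complex.I * inner ℂ e (R e)) * (1 - Complex.I * β * M z) = 1 := by
      rw [hform]
      field_simp
      linear_combination (-(Complex.I * β ^ 2 * M z ^ 2)) * Complex.I_sq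
    have hd0 : 1 + β * Complex.I * inner ℂ e (R e) ≠ 0 := left_ne_zero_of_mul_eq_one hd
    obtain ⟨S, hS1, hS2, hS⟩ := resolvent_rankOne_perturbation hA hR1 hR2 hd0
    have hS' : ∀ x, S x = R x -
        (β * Complex.I * (1 - Complex.I * β * M z) * inner ℂ e (R x)) • R e := by
      intro x
      rw [hS, div_eq_mul_inv, ← eq_inv_of_mul_eq_one_right hd]
    refine ⟨S, hS1, hS2, ?_, fun x => ?_⟩
    · rw [eq_div_iff hne] at hform
      have hMq : M z = inner ℂ e (R e) * (1 - Complex.I * β * M z) := by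
        linear_combination Complex.I * hform +
          (M z - inner ℂ e (R e)) * Complex.I_sq
      rw [hS', inner_sub_right, inner_smul_right]
      linear_combination (1 - β * Complex.I * inner ℂ e (R e)) * hMq
    · have hRb : ∀ y, ‖R y‖ * |z.im| ≤ ‖y‖ := fun y => norm_mul_abs_im_le_of_selfAdjoint hB (hR2 y)
      have h1 : ‖S x‖ ≤ ‖R x‖ + β * ‖1 - Complex.I * β * M z‖ * ‖R x‖ * ‖R e‖ := by
        rw [hS']
        refine (norm_sub_le _ _).trans ?_
        rw [norm_smul, norm_mul, norm_mul, norm_mul, Complex.norm_I, Complex.norm_real,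
          Real.norm_of_nonneg hβ.le, mul_one]
        have h2 : ‖inner ℂ e (R x)‖ ≤ ‖R x‖ := by
          simpa [he] using norm_inner_le_norm (𝕜 := ℂ) e (R x)
        gcongr
      have h3 := hRb x
      have h4 := hRb e
      rw [he] at h4
      have h5 : (‖R x‖ * |z.im|) * (‖R e‖ * |z.im|) ≤ ‖x‖ * 1 := by gcongr
      calc ‖S x‖ * z.im ^ 2
          ≤ (‖R x‖ + β * ‖1 - Complex.I * β * M z‖ * ‖R x‖ * ‖R e‖) * |z.im| ^ 2 := by
            rw [sq_abs]; gcongr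
        _ = |z.im| * (‖R x‖ * |z.im|) + β * ‖1 - Complex.I * β * M z‖ *
              ((‖R x‖ * |z.im|) * (‖R e‖ * |z.im|)) := by ring
        _ ≤ |z.im| * ‖x‖ + β * ‖1 - Complex.I * β * M z‖ * (‖x‖ * 1) := by gcongr
        _ = _ := by ring
  have hU : ∀ z ∈ Dᶜ, z ∈ resolventSet ℂ A := by
    intro z hz
    -- At a real point `B` need not have a resolvent, so holomorphy of `M` on a small closed disc is
    -- used instead; there `|1 - iβM|` is bounded by some `C`, and the growth constant is `δ + βC`.
    by_cases hzi : z.im = 0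
    · obtain ⟨x, rfl⟩ : ∃ x : ℝ, (x : ℂ) = z := ⟨z.re, by apply Complex.ext <;> simp [hzi]⟩
      obtain ⟨δ, hδ, hball⟩ := Metric.nhds_basis_closedBall.mem_iff.1 (hD.isOpen_compl.mem_nhds hz)
      have hMb := hM.mono hball
      obtain ⟨C, hCb⟩ := (isCompact_closedBall (x : ℂ) δ).exists_bound_of_continuousOn
        ((continuousOn_const (c := (1 : ℂ))).sub
          ((continuousOn_const (c := Complex.I * β)).mul hMb.continuousOn))
      choose! R hR using fun z (hz : z ∈ Metric.closedBall (x : ℂ) δ ∧ z.im ≠ 0) =>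
        hnonreal z (hball hz.1) hz.2
      have hC0 : 0 ≤ C := (norm_nonneg _).trans (hCb x (Metric.mem_closedBall_self hδ.le))
      refine mem_resolventSet_of_holomorphic_form (C := δ + β * C) (R := R) hδ hMb
        (fun z hz hzi => (hR z ⟨hz, hzi⟩).1) (fun z hz hzi => (hR z ⟨hz, hzi⟩).2.1)
        (fun z hz hzi => (hR z ⟨hz, hzi⟩).2.2.1) (fun z hz hzi y => ?_) (by positivity) hdA hdA'
      refine ((hR z ⟨hz, hzi⟩).2.2.2 y).trans ?_
      have h1 : |z.im| ≤ δ := by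
        have h2 := Complex.abs_im_le_norm (z - x)
        rw [Metric.mem_closedBall, dist_eq_norm] at hz
        simp only [Complex.sub_im, Complex.ofReal_im, sub_zero] at h2
        exact h2.trans hz
      have h3 : ‖1 - Complex.I * β * M z‖ ≤ C := hCb z hz
      gcongr
    · obtain ⟨S, hS1, hS2, -⟩ := hnonreal z hz hzi
      exact (mem_resolventSet_of_inverse hS1 hS2).1
  have hform : ∀ z ∈ Dᶜ, z.im ≠ 0 → M z = resolventForm A e z := by
    intro z hz hzi
    obtain ⟨S, hS1, hS2, hMS, -⟩ := hnonreal z hz hzi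
    rw [resolventForm, (mem_resolventSet_of_inverse hS1 hS2).2, hMS]
  have hrange : ∀ x, imPart A x ∈ Submodule.span ℂ {e} := fun x => by
    rw [him]; exact Submodule.smul_mem _ _ (Submodule.mem_span_singleton_self e)
  refine ⟨A, isPrimeOperator_of_cyclic_adjoint hβ him hdA', ?_, ?_, e, ?_, he, fun z hz =>
    ⟨hU z hz, ?_⟩⟩
  · have : imPart A = (β : ℂ) • P := by
      ext x
      rw [him, smul_apply, hP, smul_smul]
    rw [IsDissipative, this, ContinuousLinearMap.isPositive_iff_complex]
    intro x
    have h1 : inner ℂ (((β : ℂ) • P) x) x = ((β * ‖inner ℂ e x‖ ^ 2 : ℝ) : ℂ) := by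
      rw [smul_apply, hP, inner_smul_left, inner_smul_left, Complex.conj_ofReal, Complex.conj_mul']
      push_cast; ring
    rw [h1]
    refine ⟨by rw [RCLike.re_eq_complex_re, Complex.ofReal_re], ?_⟩
    rw [RCLike.re_eq_complex_re, Complex.ofReal_re]
    positivity
  · have : LinearMap.range (imPart A : H →ₗ[ℂ] H) = Submodule.span ℂ {e} := by
      apply le_antisymm
      · rintro _ ⟨x, rfl⟩
        exact hrange x
      · rw [Submodule.span_singleton_le_iff_mem]
        refine ⟨(β : ℂ)⁻¹ • e, ?_⟩
        change imPart A ((β : ℂ)⁻¹ • e) = e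
        rw [map_smul, him, hee, smul_smul, mul_one, inv_mul_cancel₀ hβ0, one_smul]
    rw [HasRankOneImPart, this, finrank_span_singleton he0]
  · refine ⟨(2 * Complex.I)⁻¹ • (β : ℂ)⁻¹ • e, ?_⟩
    change (A - ContinuousLinearMap.adjoint A) ((2 * Complex.I)⁻¹ • (β : ℂ)⁻¹ • e) = e
    have h2 : (2 * Complex.I) ≠ 0 := by simp
    rw [sub_adjoint_apply, map_smul, map_smul, him, hee, smul_inv_smul₀ h2, mul_one,
      inv_smul_smul₀ hβ0]
  -- At real points, already known to be regular for `A`, the identity follows by continuity from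
  -- nonreal ones.
  · by_cases hzi : z.im = 0
    · have hzcl : z ∈ closure {w : ℂ | w.im ≠ 0} := by
        have : Filter.Tendsto (fun t : ℝ => z + t * Complex.I) (nhdsWithin 0 {0}ᶜ) (nhds z) := by
          have h1 : Continuous fun t : ℝ => z + t * Complex.I := by fun_prop
          have h2 := h1.tendsto 0
          simp only [Complex.ofReal_zero, zero_mul, add_zero] at h2
          exact h2.mono_left nhdsWithin_le_nhds
        refine mem_closure_of_tendsto this ?_
        filter_upwards [self_mem_nhdsWithin] with t ht
        simpa [hzi] using ht
      have hne : (nhdsWithin z {w : ℂ | w.im ≠ 0}).NeBot := mem_closure_iff_nhdsWithin_neBot.1 hzcl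
      have hopen := hD.isOpen_compl.mem_nhds hz
      have h1 : Filter.Tendsto M (nhdsWithin z {w : ℂ | w.im ≠ 0}) (nhds (M z)) :=
        ((hM.differentiableAt hopen).continuousAt.tendsto).mono_left nhdsWithin_le_nhds
      have h2 : Filter.Tendsto (resolventForm A e) (nhdsWithin z {w : ℂ | w.im ≠ 0})
          (nhds (resolventForm A e z)) := by
        refine Filter.Tendsto.mono_left ?_ nhdsWithin_le_nhds
        obtain ⟨u, hu⟩ := (mem_resolventSet_iff_isUnit_sub A z).1 (hU z hz)
        have h3 : ContinuousAt (fun w : ℂ => Ring.inverse (A - algebraMap ℂ (H →L[ℂ] H) w)) z := by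
          have h4 : ContinuousAt Ring.inverse (A - algebraMap ℂ (H →L[ℂ] H) z) := by
            rw [← hu]; exact NormedRing.inverse_continuousAt u
          have h5 : ContinuousAt (fun w : ℂ => A - algebraMap ℂ (H →L[ℂ] H) w) z := by fun_prop
          exact ContinuousAt.comp (g := Ring.inverse) h4 h5
        have h6 : ContinuousAt (fun w : ℂ =>
            inner ℂ e (Ring.inverse (A - algebraMap ℂ (H →L[ℂ] H) w) e)) z :=
          continuousAt_const.inner (h3.clm_apply continuousAt_const)
        exact h6
      refine tendsto_nhds_unique_of_eventuallyEq h1 h2 ?_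
      filter_upwards [self_mem_nhdsWithin, mem_nhdsWithin_of_mem_nhds hopen] with w hw hwD
      exact hform w hwD hw
    · exact hform z hz hzi

end Model

/-! ### Integral representation of typically real functions on the disc. -/

section TypicallyReal

open Real Metric

/-- A pointwise bounded sequence of linear functionals has a pointwise limit along a
nonprincipal ultrafilter. -/
lemma exists_ultrafilter_limit_linearMap {V : Type*} [AddCommGroup V] [Module ℂ V]
    (Λ : ℕ → V →ₗ[ℂ] ℂ) (C : V → ℝ) (h : ∀ n v, ‖Λ n v‖ ≤ C v) :
    ∃ L : V →ₗ[ℂ] ℂ, ∀ v, Filter.Tendsto (fun n => Λ n v) (Filter.hyperfilter ℕ : Filter ℕ)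
      (nhds (L v)) := by
  have hlim : ∀ v, ∃ l, Filter.Tendsto (fun n => Λ n v) (Filter.hyperfilter ℕ : Filter ℕ)
      (nhds l) := by
    intro v
    obtain ⟨l, -, hl⟩ := (isCompact_closedBall (0 : ℂ) (C v)).ultrafilter_le_nhds
      ((Filter.hyperfilter ℕ).map fun n => Λ n v)
      (by
        rw [Filter.le_principal_iff, Ultrafilter.coe_map]
        exact Filter.mem_map.2 (Filter.univ_mem' fun n => by simpa using h n v))
    exact ⟨l, hl⟩
  choose L hL using hlim
  refine ⟨⟨⟨L, fun v w => ?_⟩, fun c v => ?_⟩, hL⟩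
  · refine tendsto_nhds_unique (hL (v + w)) ?_
    simpa using (hL v).add (hL w)
  · refine tendsto_nhds_unique (hL (c • v)) ?_
    simpa using (hL v).const_smul c

/-- The map `ζ ↦ 2 Re ζ` from the unit circle to `[-2, 2]`. -/
noncomputable def twoRe (ζ : ℂ) : Set.Icc (-2 : ℝ) 2 :=
  Set.projIcc (-2) 2 (by norm_num) (2 * ζ.re)

lemma continuous_twoRe : Continuous twoRe :=
  continuous_projIcc.comp (by fun_prop)

lemma coe_twoRe {ζ : ℂ} (hζ : ‖ζ‖ = 1) : ((twoRe ζ : ℝ) : ℂ) = ζ + ζ⁻¹ := by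
  have h1 : |ζ.re| ≤ 1 := hζ ▸ Complex.abs_re_le_norm ζ
  have h2 : ((twoRe ζ : ℝ)) = 2 * ζ.re := by
    rw [twoRe, Set.projIcc_of_mem _ ⟨by linarith [(abs_le.1 h1).1], by linarith [(abs_le.1 h1).2]⟩]
  have h3 : ζ⁻¹ = conj ζ := Complex.inv_eq_conj hζ
  rw [h2, h3, Complex.add_conj]

/-- The average over the unit circle of `k (2 Re ζ)` with respect to the density
`-2 Im ζ Im (f ζ)`. -/
noncomputable def circleFunctional (f : ℂ → ℂ) (hf : ContinuousOn f (sphere 0 1)) :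
    C(Set.Icc (-2 : ℝ) 2, ℂ) →ₗ[ℂ] ℂ where
  toFun k := circleAverage (fun ζ => ((-2 * ζ.im * (f ζ).im : ℝ) : ℂ) * k (twoRe ζ)) 0 1
  map_add' k l := by
    have hint : ∀ k : C(Set.Icc (-2 : ℝ) 2, ℂ), CircleIntegrable
        (fun ζ => ((-2 * ζ.im * (f ζ).im : ℝ) : ℂ) * k (twoRe ζ)) 0 1 := by
      intro k
      apply ContinuousOn.circleIntegrable zero_le_one
      have := (k.continuous.comp continuous_twoRe).continuousOn (s := sphere 0 1)
      exact ContinuousOn.mul (by fun_prop) this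
    rw [← circleAverage_fun_add (hint k) (hint l)]
    simp only [ContinuousMap.add_apply, mul_add]
  map_smul' c k := by
    rw [RingHom.id_apply, ← circleAverage_fun_smul]
    congr 1
    ext ζ
    simp
    ring

lemma circleFunctional_apply (f : ℂ → ℂ) (hf : ContinuousOn f (sphere 0 1))
    (k : C(Set.Icc (-2 : ℝ) 2, ℂ)) : circleFunctional f hf k =
      circleAverage (fun ζ => ((-2 * ζ.im * (f ζ).im : ℝ) : ℂ) * k (twoRe ζ)) 0 1 := rfl

lemma circleFunctional_nonneg {f : ℂ → ℂ} (hf : ContinuousOn f (sphere 0 1))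
    (hpos : ∀ ζ ∈ sphere (0 : ℂ) 1, ζ.im * (f ζ).im ≤ 0) {k : C(Set.Icc (-2 : ℝ) 2, ℂ)}
    (hk : 0 ≤ k) : 0 ≤ circleFunctional f hf k := by
  have hk' : ∀ t, 0 ≤ k t := fun t => hk t
  have hre : ∀ t, k t = (((k t).re : ℝ) : ℂ) := fun t => by
    apply Complex.ext <;> simp [(Complex.nonneg_iff.1 (hk' t)).2.symm]
  have h1 : (fun ζ => ((-2 * ζ.im * (f ζ).im : ℝ) : ℂ) * k (twoRe ζ)) =
      Complex.ofRealCLM ∘ fun ζ => (-2 * ζ.im * (f ζ).im) * (k (twoRe ζ)).re := by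
    ext ζ
    rw [hre (twoRe ζ)]
    simp
  have hint : CircleIntegrable (fun ζ => (-2 * ζ.im * (f ζ).im) * (k (twoRe ζ)).re) 0 1 := by
    apply ContinuousOn.circleIntegrable zero_le_one
    have := (Complex.continuous_re.comp (k.continuous.comp continuous_twoRe)).continuousOn
      (s := sphere 0 1)
    exact ContinuousOn.mul (by fun_prop) this
  rw [circleFunctional_apply, h1, Complex.ofRealCLM.circleAverage_comp_comm hint]
  rw [Complex.ofRealCLM_apply]
  refine Complex.zero_le_real.2 (circleAverage_nonneg_of_nonneg ?_)
  intro ζ hζ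
  rw [abs_one] at hζ
  have := hpos ζ hζ
  have := (Complex.nonneg_iff.1 (hk' (twoRe ζ))).1
  apply mul_nonneg _ this
  linarith

/-- The density is nonnegative and has average one. The bound does not depend on `f`, which allows a
limit over the dilates. -/
lemma norm_circleFunctional_le {f : ℂ → ℂ} (hf : ContinuousOn f (sphere 0 1))
    (hpos : ∀ ζ ∈ sphere (0 : ℂ) 1, ζ.im * (f ζ).im ≤ 0) (h1 : circleFunctional f hf 1 = 1)
    (k : C(Set.Icc (-2 : ℝ) 2, ℂ)) : ‖circleFunctional f hf k‖ ≤ ‖k‖ := by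
  set w : ℂ → ℝ := fun ζ => -2 * ζ.im * (f ζ).im with hw
  have hwc : ContinuousOn w (sphere 0 1) := by fun_prop
  have hw0 : ∀ θ : ℝ, 0 ≤ w (circleMap 0 1 θ) := by
    intro θ
    have := hpos (circleMap 0 1 θ) (circleMap_mem_sphere 0 zero_le_one θ)
    simp only [hw]; linarith
  have hwi : CircleIntegrable w 0 1 := hwc.circleIntegrable zero_le_one
  have hw1 : circleAverage w 0 1 = 1 := by
    rw [circleFunctional_apply] at h1
    have h2 : (fun ζ : ℂ => ((-2 * ζ.im * (f ζ).im : ℝ) : ℂ) *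
        (1 : C(Set.Icc (-2 : ℝ) 2, ℂ)) (twoRe ζ)) = Complex.ofRealCLM ∘ w := by
      ext ζ; simp [hw]
    rw [h2, Complex.ofRealCLM.circleAverage_comp_comm hwi, Complex.ofRealCLM_apply] at h1
    exact_mod_cast h1
  rw [circleAverage, smul_eq_mul] at hw1
  rw [circleFunctional_apply, circleAverage, norm_smul, norm_of_nonneg (by positivity)]
  have h3 : ‖∫ θ in (0 : ℝ)..2 * π, ((w (circleMap 0 1 θ) : ℝ) : ℂ) *
      k (twoRe (circleMap 0 1 θ))‖ ≤ ∫ θ in (0 : ℝ)..2 * π, w (circleMap 0 1 θ) * ‖k‖ := by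
    apply intervalIntegral.norm_integral_le_of_norm_le two_pi_pos.le
    · refine Filter.Eventually.of_forall fun θ _ => ?_
      rw [norm_mul, Complex.norm_real, norm_of_nonneg (hw0 θ)]
      exact mul_le_mul_of_nonneg_left (k.norm_coe_le_norm _) (hw0 θ)
    · exact IntervalIntegrable.mul_const hwi _
  rw [intervalIntegral.integral_mul_const] at h3
  calc _ ≤ (2 * π)⁻¹ * ((∫ θ in (0 : ℝ)..2 * π, w (circleMap 0 1 θ)) * ‖k‖) := by gcongr
    _ = ‖k‖ := by rw [← mul_assoc, hw1, one_mul]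

/-- For `f` commuting with conjugation the density may be replaced by `(ζ - ζ⁻¹) f ζ`. -/
lemma circleFunctional_eq {f : ℂ → ℂ} (hf : ContinuousOn f (sphere 0 1))
    (hsymm : ∀ ζ ∈ sphere (0 : ℂ) 1, f (conj ζ) = conj (f ζ)) (k : C(Set.Icc (-2 : ℝ) 2, ℂ)) :
    circleFunctional f hf k = circleAverage (fun ζ => (ζ - ζ⁻¹) * f ζ * k (twoRe ζ)) 0 1 := by
  -- The difference of the two integrands. It is odd under `ζ ↦ ζ̄ = ζ⁻¹`, so its average vanishes.
  set φ : ℂ → ℂ := fun ζ => ((2 * ζ.im * (f ζ).re : ℝ) : ℂ) * Complex.I * k (twoRe ζ) with hφ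
  have hkc := (k.continuous.comp continuous_twoRe).continuousOn (s := sphere 0 1)
  have hinv : ∀ ζ ∈ sphere (0 : ℂ) 1, ζ⁻¹ = conj ζ := fun ζ hζ =>
    Complex.inv_eq_conj (by simpa using hζ)
  have hodd : circleAverage φ 0 1 = 0 := by
    have h1 : circleAverage φ 0 1 = -circleAverage φ 0 1 := by
      conv_lhs => rw [← circleAverage_zero_one_congr_inv]
      rw [← neg_one_smul ℂ (circleAverage φ 0 1), ← circleAverage_fun_smul]
      apply circleAverage_congr_sphere
      intro ζ hζ
      rw [abs_one] at hζ
      simp only [hφ]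
      rw [hinv ζ hζ, hsymm ζ hζ]
      have : twoRe (conj ζ) = twoRe ζ := by simp [twoRe]
      rw [this]
      simp
    linear_combination h1 / 2
  have hφi : CircleIntegrable φ 0 1 := by
    apply ContinuousOn.circleIntegrable zero_le_one
    exact ContinuousOn.mul (by fun_prop) hkc
  have hgi : CircleIntegrable (fun ζ => ((-2 * ζ.im * (f ζ).im : ℝ) : ℂ) * k (twoRe ζ)) 0 1 := by
    apply ContinuousOn.circleIntegrable zero_le_one
    exact ContinuousOn.mul (by fun_prop) hkc
  trans circleFunctional f hf k + circleAverage φ 0 1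
  · rw [hodd, add_zero]
  rw [circleFunctional_apply, ← circleAverage_fun_add hgi hφi]
  apply circleAverage_congr_sphere
  intro ζ hζ
  rw [abs_one] at hζ
  simp only [hφ]
  rw [hinv ζ hζ, Complex.sub_conj, ← add_mul]
  congr 1
  conv_rhs => rw [← Complex.re_add_im (f ζ)]
  push_cast
  linear_combination (-2 * (ζ.im : ℂ) * (f ζ).im) * Complex.I_sq

/-- On the circle `(ζ - ζ⁻¹) f(ζ) = (ζ² - 1) f(ζ)/ζ`, which is holomorphic inside with value
`-f'(0)` at the centre; this is the mean value property. -/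
lemma circleFunctional_one {f : ℂ → ℂ} {R : ℝ} (hR : 1 < R) (hd : DifferentiableOn ℂ f (ball 0 R))
    (hf : ContinuousOn f (sphere 0 1))
    (hsymm : ∀ ζ ∈ sphere (0 : ℂ) 1, f (conj ζ) = conj (f ζ)) (h0 : f 0 = 0)
    (h1 : deriv f 0 = -1) : circleFunctional f hf 1 = 1 := by
  rw [circleFunctional_eq hf hsymm]
  have hds : DifferentiableOn ℂ (dslope f 0) (ball 0 R) :=
    (Complex.differentiableOn_dslope (ball_mem_nhds _ (by linarith))).2 hd
  have hF : DiffContOnCl ℂ (fun ζ => (ζ ^ 2 - 1) * dslope f 0 ζ) (ball 0 |1|) := by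
    apply DifferentiableOn.diffContOnCl
    rw [abs_one, closure_ball _ one_ne_zero]
    exact DifferentiableOn.mul (by fun_prop) (hds.mono (closedBall_subset_ball hR))
  have h2 := hF.circleAverage
  simp only [dslope_same, h1] at h2
  have h3 : ((0 : ℂ) ^ 2 - 1) * -1 = 1 := by norm_num
  rw [← h2.trans h3]
  apply circleAverage_congr_sphere
  intro ζ hζ
  have hζ0 : ζ ≠ 0 := by rintro rfl; simp at hζ
  simp only [ContinuousMap.one_apply, mul_one]
  rw [dslope_of_ne _ hζ0, slope_def_field, h0]
  field_simp
  ring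

/-- On the circle `k = uζ / ((ζ - u)(uζ - 1))`. The factor `ζ/(ζ - u)` is the Cauchy kernel at `u`,
and the remaining `(ζ² - 1) (f(ζ)/ζ) u/(uζ - 1)` is holomorphic in the disc and takes the value
`f(u)` at `u`. -/
lemma circleFunctional_resolvent {f : ℂ → ℂ} {R : ℝ} (hR : 1 < R)
    (hd : DifferentiableOn ℂ f (ball 0 R)) (hf : ContinuousOn f (sphere 0 1))
    (hsymm : ∀ ζ ∈ sphere (0 : ℂ) 1, f (conj ζ) = conj (f ζ)) (h0 : f 0 = 0)
    {u : ℂ} (hu0 : u ≠ 0) (hu1 : ‖u‖ < 1) {k : C(Set.Icc (-2 : ℝ) 2, ℂ)}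
    (hk : ∀ t, k t * ((t : ℝ) - (u + u⁻¹)) = 1) : circleFunctional f hf k = f u := by
  rw [circleFunctional_eq hf hsymm]
  have hds : DifferentiableOn ℂ (dslope f 0) (ball 0 R) :=
    (Complex.differentiableOn_dslope (ball_mem_nhds _ (by linarith))).2 hd
  have hne : ∀ ζ : ℂ, ‖ζ‖ ≤ 1 → u * ζ - 1 ≠ 0 := by
    intro ζ hζ h
    have h2 : ‖u * ζ‖ = 1 := by rw [sub_eq_zero.1 h, norm_one]
    rw [norm_mul] at h2
    nlinarith [norm_nonneg u, norm_nonneg ζ]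
  have hF : DiffContOnCl ℂ (fun ζ => (ζ ^ 2 - 1) * dslope f 0 ζ * (u / (u * ζ - 1)))
      (ball 0 |1|) := by
    apply DifferentiableOn.diffContOnCl
    rw [abs_one, closure_ball _ one_ne_zero]
    refine DifferentiableOn.mul (DifferentiableOn.mul (by fun_prop)
      (hds.mono (closedBall_subset_ball hR))) ?_
    exact DifferentiableOn.div (by fun_prop) (by fun_prop) fun ζ hζ => hne ζ (by simpa using hζ)
  have h2 := hF.circleAverage_smul_div (w := u) (by simpa using hu1)
  have h3 : (u ^ 2 - 1) * dslope f 0 u * (u / (u * u - 1)) = f u := by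
    have := hne u hu1.le
    rw [← sq] at this ⊢
    rw [dslope_of_ne _ hu0, slope_def_field, h0]
    field_simp
    ring
  rw [← h2.trans h3]
  apply circleAverage_congr_sphere
  intro ζ hζ
  rw [abs_one] at hζ
  have hζ1 : ‖ζ‖ = 1 := by simpa using hζ
  have hζ0 : ζ ≠ 0 := by rintro rfl; simp at hζ1
  have hζu : ζ - u ≠ 0 := by
    intro h
    rw [sub_eq_zero.1 h] at hζ1
    linarith
  have hζu' := hne ζ hζ1.le
  have hkz : k (twoRe ζ) = u * ζ / ((ζ - u) * (u * ζ - 1)) := by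
    rw [eq_div_iff (mul_ne_zero hζu hζu')]
    have h4 := hk (twoRe ζ)
    rw [coe_twoRe hζ1] at h4
    have h5 : (ζ - u) * (u * ζ - 1) = (ζ + ζ⁻¹ - (u + u⁻¹)) * (u * ζ) := by
      field_simp
      ring
    rw [h5, ← mul_assoc, h4, one_mul]
  simp only [smul_eq_mul, sub_zero]
  rw [hkz, dslope_of_ne _ hζ0, slope_def_field, h0]
  field_simp
  ring

/-- The integral representation of typically real functions on the unit disc, in the form
of a positive functional on `C([-2, 2])`. -/
lemma exists_positive_functional_of_typicallyReal {q : ℂ → ℂ}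
    (hd : DifferentiableOn ℂ q (ball 0 1)) (h0 : q 0 = 0) (h1 : deriv q 0 = -1)
    (hsymm : ∀ ζ ∈ ball (0 : ℂ) 1, q (conj ζ) = conj (q ζ))
    (hpos : ∀ ζ ∈ ball (0 : ℂ) 1, ζ.im * (q ζ).im ≤ 0) :
    ∃ L : C(Set.Icc (-2 : ℝ) 2, ℂ) →ₗ[ℂ] ℂ, (∀ k, 0 ≤ k → 0 ≤ L k) ∧ L 1 = 1 ∧
      ∀ u : ℂ, u ≠ 0 → ‖u‖ < 1 → ∀ k : C(Set.Icc (-2 : ℝ) 2, ℂ),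
        (∀ t, k t * ((t : ℝ) - (u + u⁻¹)) = 1) → L k = q u := by
  set r : ℕ → ℝ := fun n => 1 - 1 / ((n : ℝ) + 2) with hr
  have hr1 : ∀ n, r n < 1 := fun n => by
    simp only [hr, sub_lt_self_iff]; positivity
  have hr0 : ∀ n, 0 < r n := fun n => by
    simp only [hr, sub_pos]
    rw [div_lt_one (by positivity)]
    have : (0 : ℝ) ≤ n := Nat.cast_nonneg n
    linarith
  have hrlim : Filter.Tendsto r Filter.atTop (nhds 1) := by
    have h2 : Filter.Tendsto (fun n : ℕ => 1 / ((n : ℝ) + 2)) Filter.atTop (nhds 0) := by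
      simp only [one_div]
      exact Filter.Tendsto.inv_tendsto_atTop
        (Filter.tendsto_atTop_add_const_right _ _ tendsto_natCast_atTop_atTop)
    simpa [hr] using h2.const_sub 1
  -- The dilates are holomorphic across the unit circle, and division by `r n` keeps the derivative
  -- at `0` equal to `-1`.
  set f : ℕ → ℂ → ℂ := fun n ζ => q (r n * ζ) / r n with hf
  have hmaps : ∀ n, ∀ ζ : ℂ, ‖ζ‖ < (r n)⁻¹ → (r n : ℂ) * ζ ∈ ball (0 : ℂ) 1 := by
    intro n ζ hζ
    rw [mem_ball_zero_iff, norm_mul, Complex.norm_real, norm_of_nonneg (hr0 n).le]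
    calc r n * ‖ζ‖ < r n * (r n)⁻¹ := by gcongr; exact hr0 n
      _ = 1 := mul_inv_cancel₀ (hr0 n).ne'
  have hR : ∀ n, 1 < (r n)⁻¹ := fun n => (one_lt_inv₀ (hr0 n)).2 (hr1 n)
  have hfd : ∀ n, DifferentiableOn ℂ (f n) (ball 0 (r n)⁻¹) := by
    intro n
    apply DifferentiableOn.div_const
    exact hd.comp (by fun_prop) fun ζ hζ => hmaps n ζ (by simpa using hζ)
  have hfc : ∀ n, ContinuousOn (f n) (sphere 0 1) := fun n =>
    (hfd n).continuousOn.mono (sphere_subset_closedBall.trans (closedBall_subset_ball (hR n)))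
  have hsph : ∀ n, ∀ ζ ∈ sphere (0 : ℂ) 1, (r n : ℂ) * ζ ∈ ball (0 : ℂ) 1 := by
    intro n ζ hζ
    apply hmaps
    have : ‖ζ‖ = 1 := by simpa using hζ
    rw [this]; exact hR n
  have hfs : ∀ n, ∀ ζ ∈ sphere (0 : ℂ) 1, f n (conj ζ) = conj (f n ζ) := by
    intro n ζ hζ
    have := hsymm _ (hsph n ζ hζ)
    simp only [map_mul, Complex.conj_ofReal] at this
    simp only [hf, map_div₀, Complex.conj_ofReal, this]
  have hf0 : ∀ n, f n 0 = 0 := fun n => by simp [hf, h0]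
  have hf1 : ∀ n, deriv (f n) 0 = -1 := by
    intro n
    have hrn : (r n : ℂ) ≠ 0 := by exact_mod_cast (hr0 n).ne'
    have h2 : HasDerivAt q (-1) ((r n : ℂ) * 0) := by
      rw [mul_zero, ← h1]
      exact (hd.differentiableAt (ball_mem_nhds _ one_pos)).hasDerivAt
    have h3 := (h2.comp (0 : ℂ) ((hasDerivAt_id (0 : ℂ)).const_mul (r n : ℂ))).div_const (r n : ℂ)
    have h4 : HasDerivAt (f n) (-1 * (r n * 1) / r n) 0 := h3
    rw [h4.deriv]
    field_simp
  have hfp : ∀ n, ∀ ζ ∈ sphere (0 : ℂ) 1, ζ.im * (f n ζ).im ≤ 0 := by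
    intro n ζ hζ
    have h2 := hpos _ (hsph n ζ hζ)
    rw [Complex.im_ofReal_mul] at h2
    simp only [hf]
    rw [Complex.div_ofReal_im, ← mul_div_assoc]
    apply div_nonpos_of_nonpos_of_nonneg _ (hr0 n).le
    have h3 : r n * (ζ.im * (q (r n * ζ)).im) ≤ 0 := by linarith
    exact nonpos_of_mul_nonpos_right h3 (hr0 n)
  have hone : ∀ n, circleFunctional (f n) (hfc n) 1 = 1 := fun n =>
    circleFunctional_one (hR n) (hfd n) (hfc n) (hfs n) (hf0 n) (hf1 n)
  obtain ⟨L, hL⟩ := exists_ultrafilter_limit_linearMap (fun n => circleFunctional (f n) (hfc n))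
    (fun k => ‖k‖) fun n k => norm_circleFunctional_le (hfc n) (hfp n) (hone n) k
  refine ⟨L, fun k hk => ?_, ?_, fun u hu0 hu1 k hk => ?_⟩
  · exact ge_of_tendsto (hL k)
      (Filter.Eventually.of_forall fun n => circleFunctional_nonneg (hfc n) (hfp n) hk)
  · refine tendsto_nhds_unique (hL 1) ?_
    simp only [hone]
    exact tendsto_const_nhds
  · refine tendsto_nhds_unique (hL k) ?_
    have h2 : ∀ n, circleFunctional (f n) (hfc n) k = f n u := fun n =>
      circleFunctional_resolvent (hR n) (hfd n) (hfc n) (hfs n) (hf0 n) hu0 hu1 hk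
    simp only [h2]
    refine Filter.Tendsto.mono_left ?_ Nat.hyperfilter_le_atTop
    have hrc : Filter.Tendsto (fun n => (r n : ℂ)) Filter.atTop (nhds 1) := by
      exact_mod_cast (Complex.continuous_ofReal.tendsto 1).comp hrlim
    have hq : ContinuousAt q u :=
      (hd.differentiableAt (isOpen_ball.mem_nhds (by simpa using hu1))).continuousAt
    have h3 : Filter.Tendsto (fun n => (r n : ℂ) * u) Filter.atTop (nhds u) := by
      simpa using hrc.mul_const u
    have h4 := (hq.tendsto.comp h3).div hrc one_ne_zero
    rwa [div_one] at h4

end TypicallyReal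

/-! ### Herglotz–Nevanlinna functions as resolvent forms, through the Joukowski map. -/

section Herglotz

lemma mem_outsideInterval {α β : ℝ} {z : ℂ} :
    z ∈ outsideInterval α β ↔ ∀ t : ℝ, α ≤ t → t ≤ β → (t : ℂ) ≠ z := by
  simp [outsideInterval]

lemma mem_outsideInterval_of_im_ne_zero {α β : ℝ} {z : ℂ} (hz : z.im ≠ 0) :
    z ∈ outsideInterval α β := by
  rw [mem_outsideInterval]
  rintro t - - rfl
  simp at hz

lemma isOpen_outsideInterval (α β : ℝ) : IsOpen (outsideInterval α β) :=
  (isCompact_Icc.image Complex.continuous_ofReal).isClosed.isOpen_compl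

lemma outsideInterval_anti {α β α' β' : ℝ} (h1 : α' ≤ α) (h2 : β ≤ β') :
    outsideInterval α' β' ⊆ outsideInterval α β := by
  intro z hz
  rw [mem_outsideInterval] at hz ⊢
  exact fun t ht1 ht2 => hz t (h1.trans ht1) (ht2.trans h2)

/-- A point outside `[-R, R]` is nonreal or has modulus greater than `R`. -/
lemma im_ne_zero_or_lt_norm {R : ℝ} {z : ℂ} (hz : z ∈ outsideInterval (-R) R) :
    z.im ≠ 0 ∨ R < ‖z‖ := by
  by_contra! h
  obtain ⟨h1, h2⟩ := h
  rw [mem_outsideInterval] at hz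
  have h3 := abs_le.1 ((Complex.abs_re_le_norm z).trans h2)
  exact hz z.re h3.1 h3.2 (by apply Complex.ext <;> simp [h1])

lemma exists_norm_bound_of_eventually_cobounded {p : ℂ → Prop}
    (h : ∀ᶠ z in Bornology.cobounded ℂ, p z) : ∃ R : ℝ, 0 < R ∧ ∀ z, R < ‖z‖ → p z := by
  obtain ⟨R, -, hR⟩ := (Filter.hasBasis_cobounded_norm (E := ℂ)).eventually_iff.1 h
  exact ⟨max R 1, by positivity, fun z hz => hR ((le_max_left _ _).trans hz.le)⟩

/-- The Joukowski map takes the punctured unit disc to the outside of `[-2, 2]`. -/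
lemma add_inv_ne_ofReal {u : ℂ} (h0 : u ≠ 0) (h1 : ‖u‖ < 1) {t : ℝ} (ht : |t| ≤ 2) :
    u + u⁻¹ ≠ t := by
  intro h
  have hn : 0 < ‖u‖ := norm_pos_iff.2 h0
  have hquad : u ^ 2 + 1 = t * u := by
    rw [← h]; field_simp
  have him := congrArg Complex.im hquad
  have hre := congrArg Complex.re hquad
  simp [sq] at him hre
  have hsq : u.re ^ 2 + u.im ^ 2 < 1 := by
    have h2 := Complex.sq_norm u
    rw [Complex.normSq_apply] at h2
    nlinarith
  -- For real `u` in the punctured disc `|u + 1/u| > 2`. For nonreal `u` the imaginary part of the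
  -- equation forces `t = 2 Re u`, and the real part then gives `|u| = 1`.
  by_cases hi : u.im = 0
  · rw [hi] at hre hsq
    obtain ⟨ht1, ht2⟩ := abs_le.1 ht
    have : -1 < u.re ∧ u.re < 1 := by constructor <;> nlinarith
    rcases le_total 0 u.re with h3 | h3 <;> nlinarith
  · have h3 : t = 2 * u.re := by
      have : u.im * (t - 2 * u.re) = 0 := by linarith
      rcases mul_eq_zero.1 this with h4 | h4
      · exact absurd h4 hi
      · linarith
    rw [h3] at hre
    nlinarith

/-- The roots of `u² - zu + 1` have product one, so one of them lies inside the disc unless both lie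
on the circle, and then `z = 2 Re u` would be real. -/
lemma exists_add_inv_eq {z : ℂ} (hz : z.im ≠ 0) : ∃ u : ℂ, u ≠ 0 ∧ ‖u‖ < 1 ∧ u + u⁻¹ = z := by
  obtain ⟨s, hs⟩ := IsAlgClosed.exists_pow_nat_eq (z ^ 2 - 4) two_pos
  set u := (z + s) / 2 with hu
  have hquad : u * (z - u) = 1 := by
    rw [hu]; linear_combination -hs / 4
  have hu0 : u ≠ 0 := left_ne_zero_of_mul_eq_one hquad
  have hinv : u⁻¹ = z - u := (eq_inv_of_mul_eq_one_right hquad).symm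
  have hsum : u + u⁻¹ = z := by rw [hinv]; ring
  rcases lt_trichotomy ‖u‖ 1 with h | h | h
  · exact ⟨u, hu0, h, hsum⟩
  · exfalso
    apply hz
    rw [← hsum, Complex.inv_eq_conj h, Complex.add_conj]
    exact Complex.ofReal_im _
  · refine ⟨u⁻¹, inv_ne_zero hu0, ?_, by rw [inv_inv, add_comm, hsum]⟩
    rw [norm_inv]
    exact inv_lt_one_of_one_lt₀ h

lemma tendsto_add_inv_cobounded {ρ : ℝ} (hρ : 0 < ρ) :
    Filter.Tendsto (fun u : ℂ => (ρ : ℂ) * (u + u⁻¹)) (nhdsWithin 0 {0}ᶜ)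
      (Bornology.cobounded ℂ) := by
  rw [← tendsto_norm_atTop_iff_cobounded]
  have h1 : Filter.Tendsto (fun u : ℂ => ρ * (‖u⁻¹‖ + -1)) (nhdsWithin 0 {0}ᶜ) Filter.atTop :=
    (Filter.tendsto_atTop_add_const_right _ _
      (tendsto_norm_atTop_iff_cobounded.2 Filter.tendsto_inv₀_nhdsNE_zero)).const_mul_atTop hρ
  refine Filter.tendsto_atTop_mono' _ ?_ h1
  filter_upwards [mem_nhdsWithin_of_mem_nhds (Metric.ball_mem_nhds (0 : ℂ) one_pos)] with u hu
  rw [norm_mul, Complex.norm_real, Real.norm_of_nonneg hρ.le]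
  have h2 : ‖u‖ < 1 := by simpa using hu
  have h3 : ‖u⁻¹‖ ≤ ‖u + u⁻¹‖ + ‖u‖ := by
    have := norm_sub_le (u + u⁻¹) u
    rwa [add_sub_cancel_left] at this
  gcongr
  linarith

/-- A Herglotz–Nevanlinna function outside an interval that behaves like `-1 / z` at infinity is
the resolvent form of a bounded self-adjoint operator at a cyclic unit vector. -/
lemma exists_selfAdjoint_of_herglotz {F : ℂ → ℂ} {α β : ℝ}
    (hF : IsHerglotzNevanlinnaOutside F α β)
    (hlim : Filter.Tendsto (fun z => z * F z) (Bornology.cobounded ℂ) (nhds (-1))) :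
    ∃ (H : Type) (_ : NormedAddCommGroup H) (_ : InnerProductSpace ℂ H) (_ : CompleteSpace H)
      (B : H →L[ℂ] H) (e : H), ContinuousLinearMap.adjoint B = B ∧ ‖e‖ = 1 ∧
      (Submodule.span ℂ (Set.range fun n : ℕ => (B ^ n) e)).topologicalClosure = ⊤ ∧
      ∀ z : ℂ, z.im ≠ 0 → z ∈ resolventSet ℂ B ∧ resolventForm B e z = F z := by
  -- Any positive `ρ` with `[α, β] ⊆ [-2ρ, 2ρ]` would do.
  set ρ : ℝ := |α| + |β| + 1 with hρ
  have hρ0 : 0 < ρ := by positivity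
  have hρc : (ρ : ℂ) ≠ 0 := by exact_mod_cast hρ0.ne'
  have hαρ : -(2 * ρ) ≤ α := by
    have := neg_abs_le α; have := abs_nonneg β; linarith [abs_nonneg α]
  have hβρ : β ≤ 2 * ρ := by
    have := le_abs_self β; have := abs_nonneg α; linarith [abs_nonneg β]
  have hout : ∀ u : ℂ, u ≠ 0 → ‖u‖ < 1 → (ρ : ℂ) * (u + u⁻¹) ∈ outsideInterval α β := by
    intro u h0 h1
    rw [mem_outsideInterval]
    intro t ht1 ht2 h
    refine add_inv_ne_ofReal h0 h1 (t := t / ρ) ?_ ?_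
    · rw [abs_div, abs_of_pos hρ0, div_le_iff₀ hρ0, abs_le]
      constructor <;> linarith
    · push_cast
      rw [h]; field_simp
  -- The value at `0` removes the singularity, and the factor `ρ` normalizes the derivative there to
  -- `-1`, since `F(z) ~ -1/z`.
  set q : ℂ → ℂ := fun u => if u = 0 then 0 else ρ * F (ρ * (u + u⁻¹)) with hq
  have hq0 : q 0 = 0 := by simp [hq]
  have hqne : ∀ u, u ≠ 0 → q u = ρ * F (ρ * (u + u⁻¹)) := fun u hu => by simp [hq, hu]
  have hder : HasDerivAt q (-1) 0 := by
    rw [hasDerivAt_iff_tendsto_slope]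
    have h1 := hlim.comp (tendsto_add_inv_cobounded hρ0)
    have h2 : Filter.Tendsto (fun u : ℂ => u ^ 2 + 1) (nhdsWithin 0 {0}ᶜ) (nhds 1) := by
      have : Continuous fun u : ℂ => u ^ 2 + 1 := by fun_prop
      have h3 := this.tendsto 0
      norm_num at h3
      exact h3.mono_left nhdsWithin_le_nhds
    have h4 := h1.div h2 one_ne_zero
    rw [div_one] at h4
    refine h4.congr' ?_
    filter_upwards [self_mem_nhdsWithin,
      mem_nhdsWithin_of_mem_nhds (Metric.ball_mem_nhds (0 : ℂ) one_pos)] with u hu hu1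
    have hu0 : u ≠ 0 := hu
    have hne : u ^ 2 + 1 ≠ 0 := by
      intro h
      have h5 : ‖u ^ 2‖ = 1 := by rw [eq_neg_of_add_eq_zero_left h, norm_neg, norm_one]
      have h6 : ‖u‖ < 1 := by simpa using hu1
      rw [norm_pow] at h5
      nlinarith [norm_nonneg u]
    simp only [Pi.div_apply, Function.comp_apply]
    rw [slope_def_field, hq0, hqne u hu0]
    field_simp
    ring
  have hqd : DifferentiableOn ℂ q (Metric.ball 0 1) := by
    intro u hu
    apply DifferentiableAt.differentiableWithinAt
    by_cases hu0 : u = 0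
    · rw [hu0]; exact hder.differentiableAt
    · have h1 : DifferentiableAt ℂ F (ρ * (u + u⁻¹)) := hF.holo.differentiableAt
        ((isOpen_outsideInterval α β).mem_nhds (hout u hu0 (by simpa using hu)))
      have h2 : DifferentiableAt ℂ (fun u : ℂ => (ρ : ℂ) * (u + u⁻¹)) u :=
        (differentiableAt_id.add (differentiableAt_inv hu0)).const_mul _
      have h3 : DifferentiableAt ℂ (fun u : ℂ => (ρ : ℂ) * F (ρ * (u + u⁻¹))) u :=
        (DifferentiableAt.comp u h1 h2).const_mul _
      refine h3.congr_of_eventuallyEq ?_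
      filter_upwards [isOpen_ne.mem_nhds hu0] with v hv using hqne v hv
  have hqs : ∀ ζ ∈ Metric.ball (0 : ℂ) 1, q (conj ζ) = conj (q ζ) := by
    intro ζ hζ
    by_cases h0 : ζ = 0
    · simp [h0, hq0]
    · rw [hqne ζ h0, hqne _ (by simpa using h0), map_mul, Complex.conj_ofReal,
        ← hF.symm _ (hout ζ h0 (by simpa using hζ))]
      simp
  have hqp : ∀ ζ ∈ Metric.ball (0 : ℂ) 1, ζ.im * (q ζ).im ≤ 0 := by
    intro ζ hζ
    by_cases hi : ζ.im = 0
    · rw [hi, zero_mul]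
    · have h0 : ζ ≠ 0 := by rintro rfl; simp at hi
      have h1 : ‖ζ‖ < 1 := by simpa using hζ
      have hn : 0 < ‖ζ‖ := norm_pos_iff.2 h0
      have hs : 0 < Complex.normSq ζ := Complex.normSq_pos.2 h0
      have hs1 : Complex.normSq ζ < 1 := by
        rw [Complex.normSq_eq_norm_sq]; nlinarith
      -- Inside the disc the Joukowski map reverses the sign of the imaginary part, whence the
      -- reversed inequality for `q`.
      have hzi : ((ρ : ℂ) * (ζ + ζ⁻¹)).im = -(ρ * ((Complex.normSq ζ)⁻¹ - 1)) * ζ.im := by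
        rw [Complex.im_ofReal_mul, Complex.add_im, Complex.inv_im]
        ring
      have hc : 0 < ρ * ((Complex.normSq ζ)⁻¹ - 1) := by
        have := (one_lt_inv₀ hs).2 hs1
        apply mul_pos hρ0; linarith
      set c := ρ * ((Complex.normSq ζ)⁻¹ - 1) with hcdef
      have hz0 : ((ρ : ℂ) * (ζ + ζ⁻¹)).im ≠ 0 := by
        rw [hzi]; exact mul_ne_zero (neg_ne_zero.2 hc.ne') hi
      have h2 := hF.nonneg _ hz0
      rw [hqne ζ h0, Complex.im_ofReal_mul]
      set y := (F (ρ * (ζ + ζ⁻¹))).im with hy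
      rw [hzi] at h2
      have h3 : 0 ≤ y / (-c * ζ.im) * (-c * ζ.im) ^ 2 := mul_nonneg h2 (sq_nonneg _)
      have h4 : y / (-c * ζ.im) * (-c * ζ.im) ^ 2 = -(c * (ζ.im * y)) := by
        field_simp
      rw [h4] at h3
      have h5 : ζ.im * y ≤ 0 := nonpos_of_mul_nonpos_right (by linarith) hc
      nlinarith
  obtain ⟨L, hLpos, hL1, hLq⟩ :=
    exists_positive_functional_of_typicallyReal hqd hq0 hder.deriv hqs hqp
  let a : C(Set.Icc (-2 : ℝ) 2, ℂ) := ⟨fun t => ((ρ * t : ℝ) : ℂ), by fun_prop⟩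
  have ha : star a = a := by
    ext t
    exact Complex.conj_ofReal _
  have hainj : Function.Injective a := by
    intro s t h
    have h1 : ρ * (s : ℝ) = ρ * t := Complex.ofReal_injective h
    exact Subtype.ext (mul_left_cancel₀ hρ0.ne' h1)
  obtain ⟨H, i1, i2, i3, B, e, hB, he, hcyc, hres⟩ :=
    exists_selfAdjoint_cyclic_of_positive L hLpos hL1 a ha hainj
  refine ⟨H, i1, i2, i3, B, e, hB, he, hcyc, fun z hz => ?_⟩
  obtain ⟨u, hu0, hu1, huz⟩ := exists_add_inv_eq (z := z / ρ) (by
    rw [Complex.div_ofReal_im]; exact div_ne_zero hz hρ0.ne')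
  have huz' : (ρ : ℂ) * (u + u⁻¹) = z := by rw [huz]; field_simp
  have hne : ∀ t : Set.Icc (-2 : ℝ) 2, ((t : ℝ) : ℂ) - (u + u⁻¹) ≠ 0 := fun t =>
    sub_ne_zero.2 (add_inv_ne_ofReal hu0 hu1 (abs_le.2 t.2)).symm
  let k : C(Set.Icc (-2 : ℝ) 2, ℂ) := ⟨fun t => (((t : ℝ) : ℂ) - (u + u⁻¹))⁻¹,
    Continuous.inv₀ (by fun_prop) hne⟩
  have hk : ∀ t, k t * ((t : ℝ) - (u + u⁻¹)) = 1 := fun t => inv_mul_cancel₀ (hne t)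
  have hg : ∀ t, ((ρ : ℂ)⁻¹ • k) t * (a t - z) = 1 := by
    intro t
    have h1 : a t - z = ρ * ((t : ℝ) - (u + u⁻¹)) := by
      have : a t = ρ * ((t : ℝ) : ℂ) := Complex.ofReal_mul _ _
      rw [this, ← huz']; ring
    rw [h1, ContinuousMap.smul_apply, smul_eq_mul]
    calc _ = ((ρ : ℂ)⁻¹ * ρ) * (k t * ((t : ℝ) - (u + u⁻¹))) := by ring
      _ = 1 := by rw [hk, inv_mul_cancel₀ hρc, one_mul]
  obtain ⟨h1, h2⟩ := hres z _ hg
  refine ⟨h1, ?_⟩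
  rw [h2, map_smul, hLq u hu0 hu1 k hk, hqne u hu0, huz', smul_eq_mul, inv_mul_cancel_left₀ hρc]

end Herglotz

/-! ### The implications 3 → 5, 5 → 4 and 4 → 1. -/

section Equivalences

lemma HasWeylExpansion.tendsto_mul {M : ℂ → ℂ} {b : ℂ} (h : HasWeylExpansion M b) :
    Filter.Tendsto (fun z => z * M z) (Bornology.cobounded ℂ) (nhds (-1)) := by
  have hinv : Filter.Tendsto (fun z : ℂ => z⁻¹) (Bornology.cobounded ℂ) (nhds 0) :=
    Filter.tendsto_inv₀_cobounded
  have hne : ∀ᶠ z : ℂ in Bornology.cobounded ℂ, z ≠ 0 := Bornology.eventually_ne_cobounded 0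
  have h1 : Filter.Tendsto (fun z : ℂ => z * (M z - (-1 / z - b / z ^ 2)))
      (Bornology.cobounded ℂ) (nhds 0) := by
    refine ((isBigO_refl (fun z : ℂ => z) _).mul h.2).trans_tendsto ?_
    have h2 := hinv.pow 2
    rw [zero_pow two_ne_zero] at h2
    refine h2.congr' ?_
    filter_upwards [hne] with z hz
    field_simp
  have h3 := h1.add (((hinv.const_mul b).const_add 1).neg)
  simp only [mul_zero, add_zero, zero_add] at h3
  refine h3.congr' ?_
  filter_upwards [hne] with z hz
  field_simp
  ring

lemma HasWeylExpansion.tendsto_zero {M : ℂ → ℂ} {b : ℂ} (h : HasWeylExpansion M b) :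
    Filter.Tendsto M (Bornology.cobounded ℂ) (nhds 0) := by
  have h1 := (Filter.tendsto_inv₀_cobounded (α := ℂ)).mul h.tendsto_mul
  rw [zero_mul] at h1
  refine h1.congr' ?_
  filter_upwards [Bornology.eventually_ne_cobounded 0] with z hz
  rw [inv_mul_cancel_left₀ hz]

lemma HasWeylExpansion.eventually_ne_zero {M : ℂ → ℂ} {b : ℂ} (h : HasWeylExpansion M b) :
    ∀ᶠ z in Bornology.cobounded ℂ, M z ≠ 0 := by
  filter_upwards [h.tendsto_mul.eventually_ne (neg_ne_zero.2 one_ne_zero)] with z hz h0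
  exact hz (by rw [h0, mul_zero])

lemma HasWeylExpansion.eventually_norm_mul_lt_one {M : ℂ → ℂ} {b : ℂ} (h : HasWeylExpansion M b)
    (c : ℝ) : ∀ᶠ z in Bornology.cobounded ℂ, ‖M z‖ * c < 1 := by
  have h1 := h.tendsto_zero.norm.mul_const c
  rw [norm_zero, zero_mul] at h1
  exact h1.eventually_lt_const one_pos

lemma outsideInterval_mem_cobounded (α β : ℝ) :
    outsideInterval α β ∈ Bornology.cobounded ℂ :=
  Bornology.isBounded_def.1 (isCompact_Icc.image Complex.continuous_ofReal).isBounded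

lemma exists_im_pos_of_eventually_cobounded {p : ℂ → Prop}
    (h : ∀ᶠ z in Bornology.cobounded ℂ, p z) : ∃ z : ℂ, 0 < z.im ∧ p z := by
  obtain ⟨R, hR, hp⟩ := exists_norm_bound_of_eventually_cobounded h
  refine ⟨((R + 1 : ℝ) : ℂ) * Complex.I, ?_, hp _ ?_⟩
  · rw [Complex.im_ofReal_mul, Complex.I_im]; linarith
  · rw [norm_mul, Complex.norm_I, Complex.norm_real, Real.norm_of_nonneg (by linarith)]
    linarith

lemma exists_im_neg_of_eventually_cobounded {p : ℂ → Prop}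
    (h : ∀ᶠ z in Bornology.cobounded ℂ, p z) : ∃ z : ℂ, z.im < 0 ∧ p z := by
  obtain ⟨R, hR, hp⟩ := exists_norm_bound_of_eventually_cobounded h
  refine ⟨((-(R + 1) : ℝ) : ℂ) * Complex.I, ?_, hp _ ?_⟩
  · rw [Complex.im_ofReal_mul, Complex.I_im]; linarith
  · rw [norm_mul, Complex.norm_I, Complex.norm_real, norm_neg, Real.norm_of_nonneg (by linarith)]
    linarith

/-- A holomorphic function with nonnegative imaginary part is constant or has positive imaginary
part. -/
lemma eq_const_or_im_pos {g : ℂ → ℂ} {V : Set ℂ} (hV : IsOpen V) (hc : IsPreconnected V)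
    (hg : DifferentiableOn ℂ g V) (h : ∀ z ∈ V, 0 ≤ (g z).im) :
    (∃ w, ∀ z ∈ V, g z = w) ∨ ∀ z ∈ V, 0 < (g z).im := by
  refine ((hg.analyticOnNhd hV).is_constant_or_isOpen hc).imp_right fun ho z hz => ?_
  refine lt_of_le_of_ne (h z hz) fun h0 => ?_
  have hopen := ho V subset_rfl hV
  have hmem := hopen.mem_nhds (Set.mem_image_of_mem g hz)
  -- By the open mapping theorem a real value of a nonconstant `g` would be interior to the image,
  -- which would then meet the lower half-plane.
  have hcl : g z ∈ closure {w : ℂ | w.im < 0} := by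
    have : Filter.Tendsto (fun t : ℝ => g z - t * Complex.I) (nhdsWithin 0 (Set.Ioi 0))
        (nhds (g z)) := by
      have h1 : Continuous fun t : ℝ => g z - t * Complex.I := by fun_prop
      have h2 := h1.tendsto 0
      simp only [Complex.ofReal_zero, zero_mul, sub_zero] at h2
      exact h2.mono_left nhdsWithin_le_nhds
    refine mem_closure_of_tendsto this ?_
    filter_upwards [self_mem_nhdsWithin] with t ht
    simpa [← h0] using ht
  obtain ⟨_, ⟨v, hv, rfl⟩, hw⟩ := mem_closure_iff_nhds.1 hcl _ hmem
  exact absurd (h v hv) (not_le.2 hw)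

lemma im_neg_one_div (w : ℂ) : (-1 / w).im = w.im / Complex.normSq w := by
  rw [neg_div, one_div, Complex.neg_im, Complex.inv_im]
  ring

lemma weylKernel_self (M : ℂ → ℂ) (b z : ℂ) :
    weylKernel M b z z = ((((M z).im + b.im * Complex.normSq (M z)) / z.im : ℝ) : ℂ) := by
  rw [weylKernel, Complex.sub_conj, Complex.sub_conj, mul_assoc _ (M z), Complex.mul_conj]
  have : (2 * Complex.I : ℂ) ≠ 0 := by simp
  push_cast
  rw [← mul_div_mul_left _ (z.im : ℂ) this]
  congr 1 <;> ring

lemma weylKernel_conj (M : ℂ → ℂ) (b z ξ : ℂ) :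
    weylKernel M b ξ z = conj (weylKernel M b z ξ) := by
  simp only [weylKernel, map_div₀, map_add, map_sub, map_mul, Complex.conj_conj, Complex.conj_ofReal,
    Complex.conj_I, map_ofNat]
  rw [← neg_div_neg_eq]
  congr 1 <;> ring

lemma IsNonnegativeKernelOn.self_nonneg {M : ℂ → ℂ} {b : ℂ} {U : Set ℂ}
    (hK : IsNonnegativeKernelOn (weylKernel M b) U) {z : ℂ} (hz : z ∈ U) (hzi : z.im ≠ 0) :
    0 ≤ ((M z).im + b.im * Complex.normSq (M z)) / z.im := by
  have hne : z ≠ conj z := fun h => hzi (Complex.conj_eq_iff_im.1 h.symm)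
  have h := hK 1 (fun _ => z) (fun _ => 1) (fun _ => hz) fun _ _ => hne
  simp only [Finset.univ_unique, Finset.sum_singleton, map_one, mul_one, one_mul,
    weylKernel_self] at h
  exact Complex.zero_le_real.1 h

/-- The coefficients `-κ/|κ|` and `1` turn the two off-diagonal terms of the two-point form into
`-2|κ|`. -/
lemma IsNonnegativeKernelOn.norm_le {M : ℂ → ℂ} {b : ℂ} {U : Set ℂ}
    (hK : IsNonnegativeKernelOn (weylKernel M b) U) {z ξ : ℂ} (hz : z ∈ U) (hξ : ξ ∈ U)
    (hzi : z.im ≠ 0) (hξi : ξ.im ≠ 0) (hne : ξ ≠ conj z) :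
    2 * ‖weylKernel M b z ξ‖ ≤ ((M z).im + b.im * Complex.normSq (M z)) / z.im +
      ((M ξ).im + b.im * Complex.normSq (M ξ)) / ξ.im := by
  set κ := weylKernel M b z ξ with hκ
  by_cases hκ0 : κ = 0
  · rw [hκ0, norm_zero, mul_zero]
    exact add_nonneg (hK.self_nonneg hz hzi) (hK.self_nonneg hξ hξi)
  have hn : (‖κ‖ : ℂ) ≠ 0 := by simpa using hκ0
  have hne' : z ≠ conj ξ := fun h => hne (by rw [h, Complex.conj_conj])
  have hzz : z ≠ conj z := fun h => hzi (Complex.conj_eq_iff_im.1 h.symm)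
  have hξξ : ξ ≠ conj ξ := fun h => hξi (Complex.conj_eq_iff_im.1 h.symm)
  have h := hK 2 ![z, ξ] ![-(κ / ‖κ‖), 1]
    (by intro i; fin_cases i <;> simp [hz, hξ])
    (by intro i j; fin_cases i <;> fin_cases j <;> simp [hne, hne', hzz, hξξ])
  have hκκ : κ * conj κ = (‖κ‖ : ℂ) ^ 2 := Complex.mul_conj' κ
  have hsum : ∑ i, ∑ j, (![-(κ / ‖κ‖), 1] : Fin 2 → ℂ) i * conj ((![-(κ / ‖κ‖), 1] : Fin 2 → ℂ) j) *
      weylKernel M b ((![z, ξ] : Fin 2 → ℂ) j) ((![z, ξ] : Fin 2 → ℂ) i) =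
      ((((M z).im + b.im * Complex.normSq (M z)) / z.im +
      ((M ξ).im + b.im * Complex.normSq (M ξ)) / ξ.im - 2 * ‖κ‖ : ℝ) : ℂ) := by
    simp only [Fin.sum_univ_two, Matrix.cons_val_zero, Matrix.cons_val_one, map_one, map_neg,
      map_div₀, Complex.conj_ofReal]
    rw [weylKernel_conj M b z ξ, weylKernel_self, weylKernel_self, ← hκ, Complex.ofReal_sub,
      Complex.ofReal_add, Complex.ofReal_mul, Complex.ofReal_ofNat]
    field_simp
    linear_combination (((((M z).im + b.im * Complex.normSq (M z)) / z.im : ℝ) : ℂ) - 2 * ‖κ‖) * hκκ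
  rw [hsum] at h
  linarith [Complex.zero_le_real.1 h]

/-- The numerator of a nonnegative kernel vanishes at the pairs of conjugate points. -/
lemma IsNonnegativeKernelOn.symmetry {M : ℂ → ℂ} {b : ℂ} {U : Set ℂ}
    (hK : IsNonnegativeKernelOn (weylKernel M b) U) (hU : IsOpen U)
    (hM : DifferentiableOn ℂ M U) {z : ℂ} (hz : z ∈ U) (hz' : conj z ∈ U) (hzi : z.im ≠ 0) :
    M z - conj (M (conj z)) + 2 * Complex.I * (b.im : ℂ) * M z * conj (M (conj z)) = 0 := by
  set N : ℂ → ℂ := fun ξ =>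
    M z - conj (M ξ) + 2 * Complex.I * (b.im : ℂ) * M z * conj (M ξ) with hN
  set k : ℂ → ℝ := fun ξ => ((M ξ).im + b.im * Complex.normSq (M ξ)) / ξ.im with hk
  have hMc : ContinuousAt M (conj z) := (hM.differentiableAt (hU.mem_nhds hz')).continuousAt
  have hzi' : (conj z).im ≠ 0 := by simpa using hzi
  have hMcc : ContinuousAt (fun ξ => conj (M ξ)) (conj z) :=
    Complex.continuous_conj.continuousAt.comp hMc
  have hNc : ContinuousAt N (conj z) :=
    (continuousAt_const.sub hMcc).add (continuousAt_const.mul hMcc)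
  have hkc : ContinuousAt k (conj z) :=
    ((Complex.continuous_im.continuousAt.comp hMc).add
      (continuousAt_const.mul (Complex.continuous_normSq.continuousAt.comp hMc))).div
      Complex.continuous_im.continuousAt hzi'
  have hdc : ContinuousAt (fun ξ => ‖z - conj ξ‖) (conj z) :=
    (continuousAt_const.sub Complex.continuous_conj.continuousAt).norm
  have h1 : Filter.Tendsto (fun ξ => 2 * ‖N ξ‖) (nhdsWithin (conj z) {conj z}ᶜ)
      (nhds (2 * ‖N (conj z)‖)) :=
    ((hNc.norm.tendsto).const_mul 2).mono_left nhdsWithin_le_nhds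
  have h2 : Filter.Tendsto (fun ξ => ‖z - conj ξ‖ * (k z + k ξ)) (nhdsWithin (conj z) {conj z}ᶜ)
      (nhds 0) := by
    have h3 : Filter.Tendsto (fun ξ => ‖z - conj ξ‖ * (k z + k ξ)) (nhds (conj z))
        (nhds (‖z - conj (conj z)‖ * (k z + k (conj z)))) :=
      (hdc.mul ((continuousAt_const (y := k z)).add hkc)).tendsto
    rw [Complex.conj_conj, sub_self, norm_zero, zero_mul] at h3
    exact h3.mono_left nhdsWithin_le_nhds
  -- The kernel is bounded by diagonal values that stay bounded as `ξ → z̄`, while its denominator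
  -- `z - ξ̄` tends to zero; hence so does the numerator.
  have hle := le_of_tendsto_of_tendsto h1 h2 (by
    filter_upwards [self_mem_nhdsWithin, mem_nhdsWithin_of_mem_nhds (hU.mem_nhds hz'),
      mem_nhdsWithin_of_mem_nhds (Complex.continuous_im.continuousAt.eventually_ne hzi')]
      with ξ hξ hξU hξi
    have h4 := hK.norm_le hz hξU hzi hξi hξ
    have hd : z - conj ξ ≠ 0 := sub_ne_zero.2 fun h => hξ (by
      rw [Set.mem_singleton_iff, h, Complex.conj_conj])
    have h5 : N ξ = (z - conj ξ) * weylKernel M b z ξ := by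
      rw [weylKernel, mul_div_cancel₀ _ hd]
    rw [h5, norm_mul]
    calc 2 * (‖z - conj ξ‖ * ‖weylKernel M b z ξ‖)
        = ‖z - conj ξ‖ * (2 * ‖weylKernel M b z ξ‖) := by ring
      _ ≤ _ := by gcongr)
  have h6 : ‖N (conj z)‖ = 0 := le_antisymm (by linarith) (norm_nonneg _)
  exact norm_eq_zero.1 h6

/-- The values of `-1/M + b` on the lower half-plane and their reflection define the continuation.
The conjugation symmetry makes it agree with `-1/M + b` at points of the upper half-plane outside
`D`, and nonvanishing of `M` near infinity carries it across the real axis. -/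
lemma extends_neg_inv_of_nonnegativeKernel {D : Set ℂ} (hDclosed : IsClosed D)
    (hDbdd : Bornology.IsBounded D) (hDupper : D ⊆ {z : ℂ | 0 ≤ z.im}) {M : ℂ → ℂ}
    (hM : DifferentiableOn ℂ M Dᶜ) {b : ℂ} (hb : HasWeylExpansion M b)
    (hK : IsNonnegativeKernelOn (weylKernel M b) Dᶜ) :
    ExtendsToHerglotzNevanlinna (fun z => -1 / M z + b) M Dᶜ := by
  have hU : IsOpen Dᶜ := hDclosed.isOpen_compl
  have hlow : ∀ z : ℂ, z.im < 0 → z ∈ Dᶜ := fun z hz hD => absurd (hDupper hD) (not_le.2 hz)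
  have hlowle : ∀ z : ℂ, z.im < 0 → (M z).im + b.im * Complex.normSq (M z) ≤ 0 := by
    intro z hz
    have h1 := hK.self_nonneg (hlow z hz) hz.ne
    by_contra! h2
    exact absurd h1 (not_le.2 (div_neg_of_pos_of_neg h2 hz))
  -- Here `-M` has nonnegative imaginary part, so a zero would force `M` to vanish on the whole
  -- half-plane, against its expansion.
  have hMlow : ∀ z : ℂ, z.im < 0 → M z ≠ 0 := by
    have hV : IsOpen {z : ℂ | z.im < 0} := isOpen_lt Complex.continuous_im continuous_const
    have hVc : IsPreconnected {z : ℂ | z.im < 0} := (convex_halfSpace_im_lt 0).isPreconnected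
    rcases eq_const_or_im_pos (g := fun z => -M z) hV hVc (hM.mono hlow).neg (fun z hz => by
      have h1 := hlowle z hz
      have h2 := mul_nonneg hb.1.le (Complex.normSq_nonneg (M z))
      rw [Complex.neg_im]; linarith) with ⟨w, hw⟩ | hpos
    · intro z hz h0
      have hw0 : w = 0 := by rw [← hw z hz, h0, neg_zero]
      obtain ⟨v, hv, hv0⟩ := exists_im_neg_of_eventually_cobounded hb.eventually_ne_zero
      apply hv0
      rw [← neg_eq_zero, hw v hv, hw0]
    · intro z hz h0
      have := hpos z hz
      simp [h0] at this
  set f : ℂ → ℂ := fun z => -1 / M z + b with hf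
  have hrel : ∀ z ∈ Dᶜ, 0 < z.im → M z ≠ 0 ∧ f z = conj (f (conj z)) := by
    intro z hz hzi
    have hzc : (conj z).im < 0 := by simpa using hzi
    have h1 := hK.symmetry hU hM hz (hlow _ hzc) hzi.ne'
    have hm : conj (M (conj z)) ≠ 0 := by simpa using hMlow _ hzc
    have hM0 : M z ≠ 0 := by
      intro h0
      rw [h0] at h1
      simp only [zero_sub, mul_zero, zero_mul, add_zero, neg_eq_zero] at h1
      exact hm h1
    refine ⟨hM0, ?_⟩
    simp only [hf, map_add, map_div₀, map_neg, map_one]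
    have hbb : b = conj b + 2 * Complex.I * b.im := by
      have h2 := Complex.sub_conj b
      push_cast at h2
      linear_combination h2
    -- The vanishing numerator divided by `M(z)` times the conjugate of `M(z̄)`.
    have h3 : -1 / M z = -1 / conj (M (conj z)) - 2 * Complex.I * b.im := by
      field_simp
      linear_combination h1
    rw [h3]
    linear_combination hbb
  obtain ⟨R, hR0, hR⟩ := exists_norm_bound_of_eventually_cobounded
    (hb.eventually_ne_zero.and (Bornology.isBounded_def.1 hDbdd))
  have hfd : ∀ z ∈ Dᶜ, M z ≠ 0 → DifferentiableAt ℂ f z := fun z hz h0 =>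
    ((differentiableAt_const _).div (hM.differentiableAt (hU.mem_nhds hz)) h0).add_const _
  have hreal : ∀ z : ℂ, R < ‖z‖ → z.im = 0 → f z = conj (f z) := by
    intro z hz hzi
    have hfc : ContinuousAt f z := (hfd z (hR z hz).2 (hR z hz).1).continuousAt
    have hzz : conj z = z := Complex.conj_eq_iff_im.2 hzi
    have hfc' : ContinuousAt (fun w => conj (f (conj w))) z := by
      have h1 : ContinuousAt f (conj z) := by rwa [hzz]
      exact Complex.continuous_conj.continuousAt.comp
        (h1.comp (f := fun w => conj w) Complex.continuous_conj.continuousAt)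
    have hcl : z ∈ closure {w : ℂ | 0 < w.im} := by
      rw [Complex.closure_setOfPred_lt_im]
      exact hzi.ge
    have hne : (nhdsWithin z {w : ℂ | 0 < w.im}).NeBot := mem_closure_iff_nhdsWithin_neBot.1 hcl
    have h2 := tendsto_nhds_unique_of_eventuallyEq
      (hfc.tendsto.mono_left (nhdsWithin_le_nhds (s := {w : ℂ | 0 < w.im})))
      (hfc'.tendsto.mono_left nhdsWithin_le_nhds) (by
        filter_upwards [self_mem_nhdsWithin,
          mem_nhdsWithin_of_mem_nhds (hU.mem_nhds (hR z hz).2)] with w hw hwU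
        exact (hrel w hwU hw).2)
    rwa [hzz] at h2
  set F : ℂ → ℂ := fun z => if z.im ≤ 0 then f z else conj (f (conj z)) with hF
  have hFle : ∀ z : ℂ, z.im ≤ 0 → F z = f z := fun z hz => if_pos hz
  have hFgt : ∀ z : ℂ, 0 < z.im → F z = conj (f (conj z)) := fun z hz => if_neg (not_le.2 hz)
  have hFU : ∀ z ∈ Dᶜ, F z = f z := by
    intro z hz
    rcases le_or_gt z.im 0 with h | h
    · exact hFle z h
    · rw [hFgt z h, ← (hrel z hz h).2]
  refine ⟨-R, R, by linarith, F, ⟨fun z hz => ?_, fun z hz => ?_, fun z hz => ?_⟩,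
    fun z hz hzo => ⟨?_, hFU z hz⟩⟩
  · apply DifferentiableAt.differentiableWithinAt
    by_cases hzi : 0 < z.im
    · have hzc : (conj z).im < 0 := by simpa using hzi
      have h1 := (hfd _ (hlow _ hzc) (hMlow _ hzc)).conj_conj
      rw [Complex.conj_conj] at h1
      refine h1.congr_of_eventuallyEq ?_
      filter_upwards [(isOpen_lt continuous_const Complex.continuous_im).mem_nhds hzi] with w hw
      exact hFgt w hw
    · have h2 : z ∈ Dᶜ ∧ M z ≠ 0 := by
        rcases im_ne_zero_or_lt_norm hz with h | h
        · have h3 : z.im < 0 := lt_of_le_of_ne (not_lt.1 hzi) h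
          exact ⟨hlow z h3, hMlow z h3⟩
        · exact ⟨(hR z h).2, (hR z h).1⟩
      refine (hfd z h2.1 h2.2).congr_of_eventuallyEq ?_
      filter_upwards [hU.mem_nhds h2.1] with w hw using hFU w hw
  · rcases lt_trichotomy z.im 0 with h | h | h
    · have hc : 0 < (conj z).im := by simpa using h
      rw [hFgt _ hc, hFle z h.le, Complex.conj_conj]
    · have hzz : conj z = z := Complex.conj_eq_iff_im.2 h
      rw [hzz, hFle z h.le]
      exact hreal z ((im_ne_zero_or_lt_norm hz).resolve_left (not_not.2 h)) h
    · have hc : (conj z).im < 0 := by simpa using h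
      rw [hFgt z h, hFle _ hc.le, Complex.conj_conj]
  · have hneg : ∀ w : ℂ, w.im < 0 → (f w).im ≤ 0 := by
      intro w hw
      have h1 := hlowle w hw
      have h2 : 0 < Complex.normSq (M w) := Complex.normSq_pos.2 (hMlow w hw)
      simp only [hf, Complex.add_im, im_neg_one_div]
      rw [div_add' _ _ _ h2.ne']
      exact div_nonpos_of_nonpos_of_nonneg h1 h2.le
    rcases lt_or_gt_of_ne hz with h | h
    · rw [hFle z h.le]
      exact div_nonneg_of_nonpos (hneg z h) h.le
    · rw [hFgt z h, Complex.conj_im]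
      have := hneg (conj z) (by simpa using h)
      exact div_nonneg (by linarith) h.le
  · rcases im_ne_zero_or_lt_norm hzo with h | h
    · rcases lt_or_gt_of_ne h with h | h
      · exact hMlow z h
      · exact (hrel z hz h).1
    · exact (hR z h).1

/-- Algebraically `1/Q = 1/M - i Im b = -((-1/M + b) - Re b)`. The map `w ↦ -1/w` preserves the
Herglotz–Nevanlinna property, so it remains to keep `F - Re b` away from zero, at the cost of
enlarging the interval. -/
lemma extends_mobius_of_extends_neg_inv {D : Set ℂ} (hDbdd : Bornology.IsBounded D) {M : ℂ → ℂ}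
    {b : ℂ} (hb : HasWeylExpansion M b)
    (h : ExtendsToHerglotzNevanlinna (fun z => -1 / M z + b) M Dᶜ) :
    ExtendsToHerglotzNevanlinna (fun z => Complex.I * M z / (Complex.I + (b.im : ℂ) * M z))
      (fun z => Complex.I + (b.im : ℂ) * M z) Dᶜ := by
  obtain ⟨α, β, -, F, hF, hFM⟩ := h
  have hout : ∀ᶠ z in Bornology.cobounded ℂ, z ∈ outsideInterval α β :=
    outsideInterval_mem_cobounded α β
  have hDc : ∀ᶠ z in Bornology.cobounded ℂ, z ∈ Dᶜ := Bornology.isBounded_def.1 hDbdd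
  have hbc : (b.re : ℂ) + b.im * Complex.I = b := Complex.re_add_im b
  -- A constant value `w` of `F` would give `M (w - b) = -1`, impossible near infinity where `M →
  -- 0`.
  have hup : ∀ z : ℂ, 0 < z.im → 0 < (F z).im := by
    have hV : IsOpen {z : ℂ | 0 < z.im} := isOpen_lt continuous_const Complex.continuous_im
    have hVc : IsPreconnected {z : ℂ | 0 < z.im} := (convex_halfSpace_im_gt 0).isPreconnected
    rcases eq_const_or_im_pos hV hVc
      (hF.holo.mono fun z (hz : 0 < z.im) => mem_outsideInterval_of_im_ne_zero hz.ne')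
      (fun z (hz : 0 < z.im) => by
        have h1 := mul_nonneg (hF.nonneg z hz.ne') hz.le
        rwa [div_mul_cancel₀ _ hz.ne'] at h1) with ⟨w, hw⟩ | hpos
    · exfalso
      obtain ⟨z, hz, ⟨hzo, hzD⟩, hzn⟩ := exists_im_pos_of_eventually_cobounded
        ((hout.and hDc).and (hb.eventually_norm_mul_lt_one ‖w - b‖))
      obtain ⟨h0, h1⟩ := hFM z hzD hzo
      rw [hw z hz] at h1
      have h2 : M z * (w - b) = -1 := by rw [h1]; field_simp; ring
      rw [← norm_mul, h2, norm_neg, norm_one] at hzn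
      exact lt_irrefl _ hzn
    · exact hpos
  obtain ⟨R, hR0, hR⟩ := exists_norm_bound_of_eventually_cobounded
    ((hout.and hDc).and (hb.eventually_norm_mul_lt_one b.im))
  set ρ := max R (max |α| |β|) with hρ
  have hρ0 : 0 < ρ := lt_of_lt_of_le hR0 (le_max_left _ _)
  have hsub : outsideInterval (-ρ) ρ ⊆ outsideInterval α β := by
    apply outsideInterval_anti
    · have h1 : |α| ≤ ρ := (le_max_left _ _).trans (le_max_right _ _)
      linarith [neg_abs_le α]
    · have h1 : |β| ≤ ρ := (le_max_right _ _).trans (le_max_right _ _)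
      linarith [le_abs_self β]
  have hne : ∀ z ∈ outsideInterval (-ρ) ρ, F z - b.re ≠ 0 := by
    intro z hz h0
    have him : (F z).im = 0 := by
      rw [sub_eq_zero.1 h0, Complex.ofReal_im]
    rcases im_ne_zero_or_lt_norm hz with h | h
    · rcases lt_or_gt_of_ne h with h | h
      · have h1 := hup (conj z) (by simpa using h)
        rw [hF.symm z (hsub hz), Complex.conj_im, him] at h1
        simp at h1
      · exact (hup z h).ne' him
    · obtain ⟨⟨hzo, hzD⟩, hzn⟩ := hR z ((le_max_left _ _).trans_lt h)
      obtain ⟨hM0, h1⟩ := hFM z hzD hzo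
      rw [h1] at h0
      -- A zero of `F - Re b` makes `|M| Im b = 1`, while `R` was chosen so that `|M| Im b < 1`
      -- beyond it.
      have h2 : M z * (b.im * Complex.I) = 1 := by
        field_simp at h0
        linear_combination h0 + M z * hbc
      have h3 : ‖M z‖ * b.im = 1 := by
        have := congrArg norm h2
        rwa [norm_mul, norm_mul, Complex.norm_I, Complex.norm_real, Real.norm_of_nonneg hb.1.le,
          mul_one, norm_one] at this
      exact hzn.ne h3
  refine ⟨-ρ, ρ, by linarith, fun z => -1 / (F z - b.re), ⟨?_, fun z hz => ?_, fun z hz => ?_⟩,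
    fun z hz hzo => ?_⟩
  · exact (differentiableOn_const _).div ((hF.holo.mono hsub).sub_const _) hne
  · simp only [hF.symm z (hsub hz), map_div₀, map_neg, map_one, map_sub, Complex.conj_ofReal]
  · rw [im_neg_one_div, Complex.sub_im, Complex.ofReal_im, sub_zero, div_right_comm]
    exact div_nonneg (hF.nonneg z hz) (Complex.normSq_nonneg _)
  · obtain ⟨hM0, h1⟩ := hFM z hz (hsub hzo)
    have hd := hne z hzo
    have h2 : Complex.I + b.im * M z = -(Complex.I * M z) * (F z - b.re) := by
      have h3 : F z * M z = -1 + b * M z := by rw [h1]; field_simp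
      linear_combination Complex.I * h3 - Complex.I * M z * hbc + b.im * M z * Complex.I_sq
    have h4 : Complex.I + b.im * M z ≠ 0 := by
      rw [h2]
      exact mul_ne_zero (neg_ne_zero.2 (mul_ne_zero Complex.I_ne_zero hM0)) hd
    refine ⟨h4, ?_⟩
    dsimp only
    rw [div_eq_div_iff hd h4, h2]
    ring

/-- From `zM → -1` and `M → 0` follows `zQ → -1`, so `Q` is the resolvent form of a self-adjoint
operator at a cyclic unit vector `e`. Adding `i Im b (·, e) e` turns `Q` back into `M`. -/
lemma exists_weylFunction_of_extends_mobius {D : Set ℂ} (hDclosed : IsClosed D)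
    (hDbdd : Bornology.IsBounded D) {M : ℂ → ℂ} (hM : DifferentiableOn ℂ M Dᶜ) {b : ℂ}
    (hb : HasWeylExpansion M b)
    (h : ExtendsToHerglotzNevanlinna
      (fun z => Complex.I * M z / (Complex.I + (b.im : ℂ) * M z))
      (fun z => Complex.I + (b.im : ℂ) * M z) Dᶜ) :
    ∃ (H : Type) (_ : NormedAddCommGroup H) (_ : InnerProductSpace ℂ H) (_ : CompleteSpace H)
      (_ : TopologicalSpace.SeparableSpace H) (A : H →L[ℂ] H),
      IsPrimeOperator A ∧ IsDissipative A ∧ HasRankOneImPart A ∧ IsWeylFunctionOn A M Dᶜ := by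
  obtain ⟨α, β, -, F, hF, hFM⟩ := h
  have hlim : Filter.Tendsto (fun z => z * F z) (Bornology.cobounded ℂ) (nhds (-1)) := by
    have h1 := (hb.tendsto_mul.const_mul Complex.I).div
      ((hb.tendsto_zero.const_mul (b.im : ℂ)).const_add Complex.I)
      (by simp)
    have h2 : Complex.I * -1 / (Complex.I + b.im * 0) = -1 := by
      rw [mul_zero, add_zero]; field_simp
    rw [h2] at h1
    refine h1.congr' ?_
    filter_upwards [outsideInterval_mem_cobounded α β, Bornology.isBounded_def.1 hDbdd]
      with z hzo hz
    rw [(hFM z hz hzo).2]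
    simp only [Pi.div_apply]
    ring
  obtain ⟨H, i1, i2, i3, B, e, hB, he, hcyc, hres⟩ := exists_selfAdjoint_of_herglotz hF hlim
  obtain ⟨A, hA⟩ := exists_prime_dissipative_of_selfAdjoint hB he hcyc hb.1 hDclosed hM
    fun z hz hzi => by
      obtain ⟨h1, h2⟩ := hres z hzi
      obtain ⟨h3, h4⟩ := hFM z hz (mem_outsideInterval_of_im_ne_zero hzi)
      exact ⟨h1, h3, h2.trans h4⟩
  exact ⟨H, i1, i2, i3, separableSpace_of_cyclic hcyc, A, hA⟩

end Equivalences

/-! ### The cycle of implications. -/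

theorem mainTheorem4 (D : Set ℂ) (hDclosed : IsClosed D) (hDbdd : Bornology.IsBounded D)
    (hDupper : D ⊆ {z : ℂ | 0 ≤ z.im}) (M : ℂ → ℂ) (hM : DifferentiableOn ℂ M Dᶜ) :
    List.TFAE [
      -- `M` is the Weyl function of a bounded prime dissipative operator
      ∃ (H : Type) (_ : NormedAddCommGroup H) (_ : InnerProductSpace ℂ H) (_ : CompleteSpace H)
        (_ : TopologicalSpace.SeparableSpace H) (A : H →L[ℂ] H),
        IsPrimeOperator A ∧ IsDissipative A ∧ HasRankOneImPart A ∧ IsWeylFunctionOn A M Dᶜ,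
      -- expansion, and `1 - 2 i Im b M` is a characteristic function
      ∃ b : ℂ, HasWeylExpansion M b ∧
        ∃ (H : Type) (_ : NormedAddCommGroup H) (_ : InnerProductSpace ℂ H) (_ : CompleteSpace H)
          (_ : TopologicalSpace.SeparableSpace H) (A : H →L[ℂ] H),
          IsDissipative A ∧ HasRankOneImPart A ∧
            IsCharacteristicFunctionOn A (fun z => 1 - 2 * Complex.I * (b.im : ℂ) * M z) Dᶜ,
      -- expansion, and nonnegative kernel
      ∃ b : ℂ, HasWeylExpansion M b ∧ IsNonnegativeKernelOn (weylKernel M b) Dᶜ,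
      -- expansion, and continuation of `i M / (i + Im b M)`
      ∃ b : ℂ, HasWeylExpansion M b ∧
        ExtendsToHerglotzNevanlinna (fun z => Complex.I * M z / (Complex.I + (b.im : ℂ) * M z))
          (fun z => Complex.I + (b.im : ℂ) * M z) Dᶜ,
      -- expansion, and continuation of `-1 / M + b`
      ∃ b : ℂ, HasWeylExpansion M b ∧
        ExtendsToHerglotzNevanlinna (fun z => -1 / M z + b) M Dᶜ] := by
  tfae_have 1 → 2 := by
    rintro ⟨H, i1, i2, i3, i4, A, -, hA, hr, hW⟩
    obtain ⟨b, hb, hchar⟩ := weylFunction_imp_characteristicFunction hA hr hDbdd hW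
    exact ⟨b, hb, H, i1, i2, i3, i4, A, hA, hr, hchar⟩
  tfae_have 2 → 3 := by
    rintro ⟨b, hb, H, i1, i2, i3, i4, A, -, -, hchar⟩
    exact ⟨b, hb, nonnegativeKernel_of_characteristicFunction hb.1 hchar⟩
  tfae_have 3 → 5 := by
    rintro ⟨b, hb, hK⟩
    exact ⟨b, hb, extends_neg_inv_of_nonnegativeKernel hDclosed hDbdd hDupper hM hb hK⟩
  tfae_have 5 → 4 := by
    rintro ⟨b, hb, h⟩
    exact ⟨b, hb, extends_mobius_of_extends_neg_inv hDbdd hb h⟩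
  tfae_have 4 → 1 := by
    rintro ⟨b, hb, h⟩
    exact exists_weylFunction_of_extends_mobius hDclosed hDbdd hM hb h
  tfae_finish
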